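/- Let $R$ be an associative ring with unit, not necessarily commutative. Modules are left $R$-modules unless otherwise stated, and complexes are $\mathbb Z$-indexed chain complexes of modules, with differentials $X_n\to X_{n-1}$; they form the category $\mathscr C(R)$. For objects $M,N$ of an abelian category $\mathscr A$, write $N\in\underline{\mathfrak{Pr}}^{-1}_{\mathscr A}(M)$ if for every epimorphism $g:B\to N$ and every morphism $f:M\to N$ there is a morphism $h:M\to B$ with $gh=f$. A complex is finitely presented if it is bounded and all its components are finitely presented modules. For a module $M$ and $n\in\mathbb Z$, $\underline M[n]$ denotes the complex with $M$ in degree $n$ and $0$ in all other degrees. A complex $F$ is DG-flat if every $F_n$ is flat and the total tensor product complex $E\otimes^\bullet F$, with $(E\otimes^\bullet F)_n=\bigoplus_{i+j=n}E_i\otimes_R F_j$, is exact for every exact complex $E$ of right $R$-modules. The weak global dimension of $R$ is the supremum of the flat dimensions of all modules. Then the following assertions are equivalent. 1. The weak global dimension of $R$ is at most $1$. 2. For every finitely presented complex $M$ and every exact complex $N$, if $N_n\in\underline{\mathfrak{Pr}}^{-1}_{R\text{-Mod}}(M_n)$ for every $n\in\mathbb Z$, then $N\in\underline{\mathfrak{Pr}}^{-1}_{\mathscr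 C(R)}(M)$. 3. For every finitely presented module $M$, every exact complex $N$ and every $n\in\mathbb Z$, if $N_n\in\underline{\mathfrak{Pr}}^{-1}_{R\text{-Mod}}(M)$, then $N\in\underline{\mathfrak{Pr}}^{-1}_{\mathscr C(R)}(\underline M[n])$. 4. Every subcomplex of a DG-flat complex is DG-flat. -/

import Mathlib

open CategoryTheory

universe u

namespace SubprojComplex

section Subprojectivity

/-- `M` is `N`-subprojective: every morphism `M ⟶ N` lifts through every epimorphism onto `N`. -/
def IsSubprojective {C : Type*} [Category C] (M N : C) : Prop :=
  ∀ ⦃B : C⦄ (g : B ⟶ N) [Epi g] (f : M ⟶ N), ∃ h : M ⟶ B, h ≫ g = f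

/-- The subprojectivity domain of `M`: the class of all objects `N` such that
`M` is `N`-subprojective. -/
def subprojectivityDomain {C : Type*} [Category C] (M : C) : Set C :=
  {N | IsSubprojective M N}

end Subprojectivity

section Tensor

/-! ### The tensor product of a right and a left module over an arbitrary ring

Right `R`-modules are modules over `Rᵐᵒᵖ`. -/

variable (R : Type*) [Ring R]

/-- The subgroup of `A ⊗[ℤ] B` generated by all `(a r) ⊗ b - a ⊗ (r b)`. -/
def balancedRelations (A : Type*) [AddCommGroup A] [Module Rᵐᵒᵖ A]
    (B : Type*) [AddCommGroup B] [Module R B] : AddSubgroup (TensorProduct ℤ A B) :=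
  AddSubgroup.closure {t | ∃ (a : A) (r : R) (b : B),
    t = TensorProduct.tmul ℤ (MulOpposite.op r • a) b - TensorProduct.tmul ℤ a (r • b)}

/-- The tensor product `A ⊗_R B` of a right `R`-module `A` and a left `R`-module `B`. -/
abbrev RTensor (A : Type*) [AddCommGroup A] [Module Rᵐᵒᵖ A]
    (B : Type*) [AddCommGroup B] [Module R B] : Type _ :=
  TensorProduct ℤ A B ⧸ balancedRelations R A B

variable {A A' B B' : Type*}
  [AddCommGroup A] [Module Rᵐᵒᵖ A] [AddCommGroup A'] [Module Rᵐᵒᵖ A']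
  [AddCommGroup B] [Module R B] [AddCommGroup B'] [Module R B']

/-- The pure tensor `a ⊗ b` in `A ⊗_R B`. -/
def rtmul (a : A) (b : B) : RTensor R A B :=
  QuotientAddGroup.mk (TensorProduct.tmul ℤ a b)

/-- The map `f ⊗ g : A ⊗_R B → A' ⊗_R B'`, `a ⊗ b ↦ f a ⊗ g b`. -/
def RTensor.map (f : A →ₗ[Rᵐᵒᵖ] A') (g : B →ₗ[R] B') : RTensor R A B →+ RTensor R A' B' :=
  QuotientAddGroup.map _ _ (TensorProduct.map f.toAddMonoidHom.toIntLinearMap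
    g.toAddMonoidHom.toIntLinearMap).toAddMonoidHom (by
      rw [balancedRelations, AddSubgroup.closure_le]
      rintro _ ⟨a, r, b, rfl⟩
      exact AddSubgroup.subset_closure ⟨f a, r, g b, by simp⟩)

theorem RTensor.map_rtmul (f : A →ₗ[Rᵐᵒᵖ] A') (g : B →ₗ[R] B') (a : A) (b : B) :
    RTensor.map R f g (rtmul R a b) = rtmul R (f a) (g b) := rfl

theorem rtmul_zero_left (b : B) : rtmul R (0 : A) b = 0 := by
  simp [rtmul]

theorem rtmul_zero_right (a : A) : rtmul R a (0 : B) = 0 := by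
  simp [rtmul]

/-- Additive maps out of `A ⊗_R B` which agree on pure tensors are equal. -/
theorem RTensor.addHom_ext {G : Type*} [AddCommGroup G] {f g : RTensor R A B →+ G}
    (h : ∀ (a : A) (b : B), f (rtmul R a b) = g (rtmul R a b)) : f = g := by
  ext t
  induction t using TensorProduct.induction_on with
  | zero => simp
  | tmul a b => exact h a b
  | add x y hx hy => rw [map_add, map_add, hx, hy]

end Tensor

section Flat

variable (R : Type u) [Ring R]

/-- A left `R`-module `M` is flat if `- ⊗_R M` preserves injectivity of maps of
right `R`-modules. -/
def IsFlat (M : Type u) [AddCommGroup M] [Module R M] : Prop :=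
  ∀ ⦃A A' : Type u⦄ [AddCommGroup A] [Module Rᵐᵒᵖ A] [AddCommGroup A'] [Module Rᵐᵒᵖ A']
    (f : A →ₗ[Rᵐᵒᵖ] A'), Function.Injective f →
      Function.Injective (RTensor.map R f (LinearMap.id : M →ₗ[R] M))

/-- `HasFlatDimensionLE R n M`: there is an exact sequence
`0 → F_n → ⋯ → F_1 → F_0 → M → 0` of left `R`-modules with all `F_i` flat
(spliced from the short exact sequences `0 → K → F_0 → M → 0`, where `K` is resolved
in length `n - 1`). -/
def HasFlatDimensionLE : ℕ → ModuleCat.{u} R → Prop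
  | 0, M => IsFlat R M
  | n + 1, M => ∃ (K F : ModuleCat.{u} R) (i : K →ₗ[R] F) (p : F →ₗ[R] M),
      Function.Injective i ∧ Function.Exact i p ∧ Function.Surjective p ∧
        IsFlat R F ∧ HasFlatDimensionLE n K

/-- The flat dimension of a left `R`-module: the least length of a flat resolution
(`⊤` if there is no finite one). -/
noncomputable def flatDimension (M : ModuleCat.{u} R) : ℕ∞ :=
  ⨅ (n : ℕ) (_ : HasFlatDimensionLE R n M), (n : ℕ∞)

/-- The weak global dimension of `R`: the supremum of the flat dimensions of all
left `R`-modules. -/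
noncomputable def weakGlobalDimension : ℕ∞ :=
  ⨆ M : ModuleCat.{u} R, flatDimension R M

end Flat

section Complexes

variable {R : Type u} [Ring R]

/-- A complex of left `R`-modules is finitely presented if it is bounded and all of its
components are finitely presented. -/
def IsFinitelyPresentedComplex (M : ChainComplex (ModuleCat.{u} R) ℤ) : Prop :=
  (∃ a b : ℤ, ∀ n : ℤ, n < a ∨ b < n → Limits.IsZero (M.X n)) ∧
    ∀ n : ℤ, Module.FinitePresentation R (M.X n)

/-- The complex with `M` in degree `n` and zero elsewhere, i.e. the shift by `n` of the sphere
complex of `M`. -/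
noncomputable abbrev shiftedSphere (M : ModuleCat.{u} R) (n : ℤ) :
    ChainComplex (ModuleCat.{u} R) ℤ :=
  (HomologicalComplex.single (ModuleCat.{u} R) (ComplexShape.down ℤ) n).obj M

variable (E : ChainComplex (ModuleCat.{u} Rᵐᵒᵖ) ℤ) (F : ChainComplex (ModuleCat.{u} R) ℤ)

/-- The group `(E ⊗ F)_n = ⨁_{i + j = n} E_i ⊗_R F_j`. -/
abbrev tensorX (n : ℤ) : Type u :=
  DirectSum {p : ℤ × ℤ // p.1 + p.2 = n} fun p => RTensor R (E.X p.1.1) (F.X p.1.2)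

/-- The element `x ⊗ y` of `(E ⊗ F)_n`, where `x ∈ E_i`, `y ∈ F_j` and `i + j = n`. -/
noncomputable def tensorOf {n : ℤ} (i j : ℤ) (h : i + j = n) :
    RTensor R (E.X i) (F.X j) →+ tensorX E F n :=
  DirectSum.of (fun p : {p : ℤ × ℤ // p.1 + p.2 = n} => RTensor R (E.X p.1.1) (F.X p.1.2))
    ⟨(i, j), h⟩

/-- The differential of `E ⊗ F`, from degree `m` to degree `n` where `n + 1 = m`:
`d (x ⊗ y) = d x ⊗ y + (-1) ^ i • (x ⊗ d y)` for `x ∈ E_i`. -/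
noncomputable def tensorD (m n : ℤ) (h : n + 1 = m) : tensorX E F m →+ tensorX E F n :=
  DirectSum.toAddMonoid fun p =>
    (tensorOf E F (p.1.1 - 1) p.1.2 (by have := p.2; omega)).comp
      (RTensor.map R (E.d p.1.1 (p.1.1 - 1)).hom LinearMap.id) +
    (Int.negOnePow p.1.1 : ℤ) •
      (tensorOf E F p.1.1 (p.1.2 - 1) (by have := p.2; omega)).comp
        (RTensor.map R LinearMap.id (F.d p.1.2 (p.1.2 - 1)).hom)

theorem tensorD_rtmul (m n : ℤ) (h : n + 1 = m) (i j : ℤ) (hij : i + j = m)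
    (x : E.X i) (y : F.X j) :
    tensorD E F m n h (tensorOf E F i j hij (rtmul R x y)) =
      tensorOf E F (i - 1) j (by omega) (rtmul R (E.d i (i - 1) x) y) +
      (Int.negOnePow i : ℤ) •
        tensorOf E F i (j - 1) (by omega) (rtmul R x (F.d j (j - 1) y)) := by
  unfold tensorD
  conv_lhs => enter [2]; unfold tensorOf
  rw [DirectSum.toAddMonoid_of]
  rfl

theorem tensorD_comp (l m n : ℤ) (h : m + 1 = l) (h' : n + 1 = m) :
    (tensorD E F m n h').comp (tensorD E F l m h) = 0 := by
  refine DirectSum.addHom_ext' ?_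
  rintro ⟨⟨i, j⟩, hij⟩
  refine RTensor.addHom_ext R fun x y => ?_
  change tensorD E F m n h' (tensorD E F l m h (tensorOf E F i j hij (rtmul R x y))) = 0
  have hE : E.d (i - 1) (i - 1 - 1) (E.d i (i - 1) x) = 0 := by
    rw [← ModuleCat.comp_apply, E.d_comp_d]; rfl
  have hF : F.d (j - 1) (j - 1 - 1) (F.d j (j - 1) y) = 0 := by
    rw [← ModuleCat.comp_apply, F.d_comp_d]; rfl
  rw [tensorD_rtmul, map_add, map_zsmul, tensorD_rtmul, tensorD_rtmul, hE, hF,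
    rtmul_zero_left R, rtmul_zero_right R, Int.negOnePow_sub, Int.negOnePow_one]
  simp

/-- The tensor product complex `E ⊗ F` of a complex `E` of right `R`-modules and a complex `F` of
left `R`-modules, a complex of abelian groups. -/
noncomputable def tensorComplex : ChainComplex AddCommGrpCat.{u} ℤ where
  X n := AddCommGrpCat.of (tensorX E F n)
  d m n := if h : n + 1 = m then AddCommGrpCat.ofHom (tensorD E F m n h) else 0
  shape m n h := dif_neg h
  d_comp_d' l m n h h' := by
    have h1 : m + 1 = l := h
    have h2 : n + 1 = m := h'
    rw [dif_pos h1, dif_pos h2, ← AddCommGrpCat.ofHom_comp, tensorD_comp]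
    rfl

/-- A complex `F` of left `R`-modules is DG-flat if all of its components are flat and
`E ⊗ F` is exact for every exact complex `E` of right `R`-modules. -/
def IsDGFlat (F : ChainComplex (ModuleCat.{u} R) ℤ) : Prop :=
  (∀ n : ℤ, IsFlat R (F.X n)) ∧
    ∀ E : ChainComplex (ModuleCat.{u} Rᵐᵒᵖ) ℤ, E.Acyclic → (tensorComplex E F).Acyclic

end Complexes

end SubprojComplex

/-! Everything is compared with one condition, `SubmodulesOfFlatAreFlat`. It is equivalent to weak
global dimension at most 1: if L ≤ F with F flat, pulling a flat resolution 0 → K → G → F/L → 0 back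
along F → F/L gives a module which is an extension of F by K, hence flat, and which maps onto the
flat module G with kernel L (`weakGlobalDimension_le_one_iff`).

Flatness meets lifting through Lazard's criterion: N is flat exactly when maps from finitely
presented modules to N lift through epimorphisms onto N (`IsFlat.exists_lift`, `isFlat_of_lifts`).

For 1 → 2, a chain map M → N is lifted degree by degree, from below, through an epimorphism P → N
with P exact and componentwise flat. Degreewise lifts exist by hypothesis. Their failure to commute
with the differentials takes values in the cycles of the kernel of P → N. That kernel is exact and
its cycles are flat, so the error lifts and can be subtracted (`exists_lift_step`). An arbitrary B →
N is reduced to this case by covering B with a sum of discs on free modules.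

Assertion 3 is the special case of spheres. For 3 → 1 it is applied to the exact complex 0 → L → F →
F/L → 0. A map from a finitely presented M to L becomes a map from a sphere; its lift to the disc
cover has values in cycles, so the map to L factors through a free module
(`isFlat_of_forall_shiftedSphere`).

For 1 → 4, every complex G of flat modules is DG-flat: in 0 → Z → G → B → 0 the cycles Z and
boundaries B are flat with zero differential, hence DG-flat, and the sequence stays exact under
tensoring (`isDGFlat_of_submodulesOfFlatAreFlat`). For 4 → 1, spheres on L ≤ F suffice. -/

namespace SubprojComplex

/-! ### Tensor products over a noncommutative ring: right exactness and free modules. -/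

section TensorLemmas

variable (R : Type*) [Ring R]
variable {A A' A'' B B' B'' : Type*}
  [AddCommGroup A] [Module Rᵐᵒᵖ A] [AddCommGroup A'] [Module Rᵐᵒᵖ A']
  [AddCommGroup A''] [Module Rᵐᵒᵖ A'']
  [AddCommGroup B] [Module R B] [AddCommGroup B'] [Module R B']
  [AddCommGroup B''] [Module R B'']

theorem rtmul_add_left (a a' : A) (b : B) :
    rtmul R (a + a') b = rtmul R a b + rtmul R a' b := by
  simp only [rtmul, TensorProduct.add_tmul, QuotientAddGroup.mk_add]

theorem rtmul_add_right (a : A) (b b' : B) :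
    rtmul R a (b + b') = rtmul R a b + rtmul R a b' := by
  simp only [rtmul, TensorProduct.tmul_add, QuotientAddGroup.mk_add]

theorem rtmul_smul (a : A) (r : R) (b : B) :
    rtmul R (MulOpposite.op r • a) b = rtmul R a (r • b) := by
  rw [← sub_eq_zero]
  exact (QuotientAddGroup.eq_zero_iff _).2 (AddSubgroup.subset_closure ⟨a, r, b, rfl⟩)

/-- `a ↦ a ⊗ b`. -/
def rtmulLeft (b : B) : A →+ RTensor R A B :=
  AddMonoidHom.mk' (fun a => rtmul R a b) fun a a' => rtmul_add_left R a a' b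

/-- `b ↦ a ⊗ b`. -/
def rtmulRight (a : A) : B →+ RTensor R A B :=
  AddMonoidHom.mk' (fun b => rtmul R a b) fun b b' => rtmul_add_right R a b b'

theorem RTensor.induction {p : RTensor R A B → Prop} (h0 : p 0)
    (ht : ∀ a b, p (rtmul R a b)) (ha : ∀ x y, p x → p y → p (x + y)) (x : RTensor R A B) :
    p x := by
  obtain ⟨t, rfl⟩ := QuotientAddGroup.mk_surjective x
  induction t using TensorProduct.induction_on with
  | zero => exact h0
  | tmul a b => exact ht a b
  | add x y hx hy => exact ha _ _ hx hy

/-- The universal property of `A ⊗_R B`. -/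
def RTensor.lift {G : Type*} [AddCommGroup G] (β : A →+ B →+ G)
    (h : ∀ a (r : R) b, β (MulOpposite.op r • a) b = β a (r • b)) : RTensor R A B →+ G :=
  QuotientAddGroup.lift _ (TensorProduct.liftAddHom β fun r a b => by simp) (by
    rw [balancedRelations, AddSubgroup.closure_le]
    rintro _ ⟨a, r, b, rfl⟩
    simp [AddMonoidHom.mem_ker, h])

theorem RTensor.map_map (f : A →ₗ[Rᵐᵒᵖ] A') (f' : A' →ₗ[Rᵐᵒᵖ] A'') (g : B →ₗ[R] B')
    (g' : B' →ₗ[R] B'') (x : RTensor R A B) :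
    RTensor.map R f' g' (RTensor.map R f g x) = RTensor.map R (f' ∘ₗ f) (g' ∘ₗ g) x :=
  DFunLike.congr_fun (f := (RTensor.map R f' g').comp (RTensor.map R f g))
    (g := RTensor.map R (f' ∘ₗ f) (g' ∘ₗ g)) (RTensor.addHom_ext R fun _ _ => rfl) x

theorem RTensor.map_id (x : RTensor R A B) :
    RTensor.map R (LinearMap.id : A →ₗ[Rᵐᵒᵖ] A) (LinearMap.id : B →ₗ[R] B) x = x :=
  DFunLike.congr_fun (f := RTensor.map R LinearMap.id LinearMap.id) (g := AddMonoidHom.id _)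
    (RTensor.addHom_ext R fun _ _ => rfl) x

theorem RTensor.map_comm (f : A →ₗ[Rᵐᵒᵖ] A') (g : B →ₗ[R] B') (x : RTensor R A B) :
    RTensor.map R f LinearMap.id (RTensor.map R LinearMap.id g x) =
      RTensor.map R LinearMap.id g (RTensor.map R f LinearMap.id x) := by
  rw [RTensor.map_map, RTensor.map_map]; rfl

theorem RTensor.map_zero_left (g : B →ₗ[R] B') (x : RTensor R A B) :
    RTensor.map R (0 : A →ₗ[Rᵐᵒᵖ] A') g x = 0 :=
  DFunLike.congr_fun (g := 0) (RTensor.addHom_ext R fun _ b => rtmul_zero_left R (g b)) x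

theorem RTensor.map_zero_right (f : A →ₗ[Rᵐᵒᵖ] A') (x : RTensor R A B) :
    RTensor.map R f (0 : B →ₗ[R] B') x = 0 :=
  DFunLike.congr_fun (g := 0) (RTensor.addHom_ext R fun a _ => rtmul_zero_right R (f a)) x

theorem RTensor.map_surjective {f : A →ₗ[Rᵐᵒᵖ] A'} {g : B →ₗ[R] B'}
    (hf : Function.Surjective f) (hg : Function.Surjective g) :
    Function.Surjective (RTensor.map R f g) := by
  intro x
  induction x using RTensor.induction with
  | h0 => exact ⟨0, map_zero _⟩
  | ht a b =>
    obtain ⟨a, rfl⟩ := hf a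
    obtain ⟨b, rfl⟩ := hg b
    exact ⟨rtmul R a b, rfl⟩
  | ha x y hx hy =>
    obtain ⟨x, rfl⟩ := hx
    obtain ⟨y, rfl⟩ := hy
    exact ⟨x + y, map_add _ _ _⟩

/-- `A ⊗_R -` is right exact. -/
theorem RTensor.exact_right (A : Type*) [AddCommGroup A] [Module Rᵐᵒᵖ A]
    {i : B →ₗ[R] B'} {p : B' →ₗ[R] B''}
    (h : Function.Exact i p) (hp : Function.Surjective p) :
    Function.Exact (RTensor.map R (LinearMap.id : A →ₗ[Rᵐᵒᵖ] A) i)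
      (RTensor.map R (LinearMap.id : A →ₗ[Rᵐᵒᵖ] A) p) := by
  intro x
  constructor
  · intro hx
    let I := (RTensor.map R (LinearMap.id : A →ₗ[Rᵐᵒᵖ] A) i).range
    let q := QuotientAddGroup.mk' I
    obtain ⟨s, hs⟩ := hp.hasRightInverse
    -- Modulo the image of `i`, a tensor depends on `b` only through `p b`. So the set-theoretic
    -- section `s` induces an additive map ψ on A ⊗ B'' through which the quotient map `q` factors.
    have key : ∀ (a : A) (b b' : B'), p b = p b' → q (rtmul R a b) = q (rtmul R a b') := by
      intro a b b' hb
      obtain ⟨k, hk⟩ := (h (b' - b)).1 (by rw [map_sub, hb, sub_self])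
      refine QuotientAddGroup.eq.2 ⟨rtmul R a k, ?_⟩
      rw [RTensor.map_rtmul, hk, sub_eq_neg_add, rtmul_add_right]
      exact congrArg (· + _) (map_neg (rtmulRight R a) b)
    let ψ : RTensor R A B'' →+ RTensor R A B' ⧸ I := RTensor.lift R
      (AddMonoidHom.mk' (fun a => AddMonoidHom.mk' (fun c => q (rtmul R a (s c))) fun c c' => by
          rw [← map_add, ← rtmul_add_right]
          exact key _ _ _ (by simp only [map_add, hs _]))
        fun a a' => by
          ext c
          change q (rtmul R (a + a') (s c)) = q (rtmul R a (s c)) + q (rtmul R a' (s c))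
          rw [← map_add, ← rtmul_add_left])
      fun a r c => by
        change q (rtmul R (MulOpposite.op r • a) (s c)) = q (rtmul R a (s (r • c)))
        rw [rtmul_smul]
        exact key _ _ _ (by simp only [map_smul, hs _])
    have hψ : ψ.comp (RTensor.map R LinearMap.id p) = q :=
      RTensor.addHom_ext R fun a b => key _ _ _ (hs _)
    have : q x = 0 := by
      rw [← hψ, AddMonoidHom.comp_apply, hx, map_zero]
    exact (QuotientAddGroup.eq_zero_iff _).1 this
  · rintro ⟨y, rfl⟩
    rw [RTensor.map_map, show p ∘ₗ i = 0 from LinearMap.ext h.apply_apply_eq_zero,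
      RTensor.map_zero_right]

/-- `- ⊗_R B` is right exact. -/
theorem RTensor.exact_left (B : Type*) [AddCommGroup B] [Module R B]
    {i : A →ₗ[Rᵐᵒᵖ] A'} {p : A' →ₗ[Rᵐᵒᵖ] A''}
    (h : Function.Exact i p) (hp : Function.Surjective p) :
    Function.Exact (RTensor.map R i (LinearMap.id : B →ₗ[R] B))
      (RTensor.map R p (LinearMap.id : B →ₗ[R] B)) := by
  intro x
  constructor
  · intro hx
    let I := (RTensor.map R i (LinearMap.id : B →ₗ[R] B)).range
    let q := QuotientAddGroup.mk' I
    obtain ⟨s, hs⟩ := hp.hasRightInverse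
    have key : ∀ (b : B) (a a' : A'), p a = p a' → q (rtmul R a b) = q (rtmul R a' b) := by
      intro b a a' ha
      obtain ⟨k, hk⟩ := (h (a' - a)).1 (by rw [map_sub, ha, sub_self])
      refine QuotientAddGroup.eq.2 ⟨rtmul R k b, ?_⟩
      rw [RTensor.map_rtmul, hk, sub_eq_neg_add, rtmul_add_left]
      exact congrArg (· + _) (map_neg (rtmulLeft R b) a)
    let ψ : RTensor R A'' B →+ RTensor R A' B ⧸ I := RTensor.lift R
      (AddMonoidHom.mk' (fun c => AddMonoidHom.mk' (fun b => q (rtmul R (s c) b)) fun b b' => by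
          rw [← map_add, ← rtmul_add_right])
        fun c c' => by
          ext b
          change q (rtmul R (s (c + c')) b) = q (rtmul R (s c) b) + q (rtmul R (s c') b)
          rw [← map_add, ← rtmul_add_left]
          exact key _ _ _ (by simp only [map_add, hs _]))
      fun c r b => by
        change q (rtmul R (s (MulOpposite.op r • c)) b) = q (rtmul R (s c) (r • b))
        rw [← rtmul_smul]
        exact key _ _ _ (by simp only [map_smul, hs _])
    have hψ : ψ.comp (RTensor.map R p LinearMap.id) = q :=
      RTensor.addHom_ext R fun a b => key _ _ _ (hs _)
    have : q x = 0 := by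
      rw [← hψ, AddMonoidHom.comp_apply, hx, map_zero]
    exact (QuotientAddGroup.eq_zero_iff _).1 this
  · rintro ⟨y, rfl⟩
    rw [RTensor.map_map, show p ∘ₗ i = 0 from LinearMap.ext h.apply_apply_eq_zero,
      RTensor.map_zero_left]

/-- `A ⊗_R R^(ι) → A^(ι)`. -/
noncomputable def tensorFinsupp (ι : Type*) (A : Type*) [AddCommGroup A] [Module Rᵐᵒᵖ A] :
    RTensor R A (ι →₀ R) →+ (ι →₀ A) :=
  RTensor.lift R
    (AddMonoidHom.mk' (fun a => Finsupp.mapRange.addMonoidHom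
        (AddMonoidHom.mk' (fun r => MulOpposite.op r • a) fun r r' => by
          rw [MulOpposite.op_add, add_smul]))
      fun a a' => by ext; simp)
    fun a r v => by ext; simp [mul_smul]

/-- The map σ sending a in position i to a ⊗ e_i is a left inverse. -/
theorem tensorFinsupp_injective (ι : Type*) (A : Type*) [AddCommGroup A] [Module Rᵐᵒᵖ A] :
    Function.Injective (tensorFinsupp R ι A) := by
  let σ : (ι →₀ A) →+ RTensor R A (ι →₀ R) :=
    Finsupp.liftAddHom fun i => rtmulLeft R (Finsupp.single i 1)
  have h : σ.comp (tensorFinsupp R ι A) = AddMonoidHom.id _ := by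
    refine RTensor.addHom_ext R fun a v => ?_
    induction v using Finsupp.induction_linear with
    | zero => rw [rtmul_zero_right, map_zero, map_zero]
    | add f g hf hg => rw [rtmul_add_right, map_add, map_add, hf, hg]
    | single i r =>
      change σ (Finsupp.mapRange.addMonoidHom _ (Finsupp.single i r)) = rtmul R a _
      simp only [Finsupp.mapRange.addMonoidHom_apply, Finsupp.mapRange_single, σ,
        Finsupp.liftAddHom_apply_single]
      change rtmul R (MulOpposite.op r • a) _ = _
      rw [rtmul_smul, Finsupp.smul_single, smul_eq_mul, mul_one]
  exact Function.LeftInverse.injective (g := σ) (DFunLike.congr_fun h)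

/-- `R^(ι) ⊗_R B → B^(ι)`. -/
noncomputable def finsuppTensor (ι : Type*) (B : Type*) [AddCommGroup B] [Module R B] :
    RTensor R (ι →₀ Rᵐᵒᵖ) B →+ (ι →₀ B) :=
  RTensor.lift R
    (AddMonoidHom.flip (AddMonoidHom.mk' (fun b => Finsupp.mapRange.addMonoidHom
        (AddMonoidHom.mk' (fun r : Rᵐᵒᵖ => r.unop • b) fun r r' => by
          rw [MulOpposite.unop_add, add_smul]))
      fun b b' => by ext; simp))
    fun a r v => by ext; simp [mul_smul]

theorem finsuppTensor_injective (ι : Type*) (B : Type*) [AddCommGroup B] [Module R B] :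
    Function.Injective (finsuppTensor R ι B) := by
  let σ : (ι →₀ B) →+ RTensor R (ι →₀ Rᵐᵒᵖ) B :=
    Finsupp.liftAddHom fun i => rtmulRight R (Finsupp.single i 1)
  have h : σ.comp (finsuppTensor R ι B) = AddMonoidHom.id _ := by
    refine RTensor.addHom_ext R fun v b => ?_
    induction v using Finsupp.induction_linear with
    | zero => rw [rtmul_zero_left, map_zero, map_zero]
    | add f g hf hg => rw [rtmul_add_left, map_add, map_add, hf, hg]
    | single i r =>
      change σ (Finsupp.mapRange.addMonoidHom _ (Finsupp.single i r)) = rtmul R _ b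
      simp only [Finsupp.mapRange.addMonoidHom_apply, Finsupp.mapRange_single, σ,
        Finsupp.liftAddHom_apply_single]
      change rtmul R _ (r.unop • b) = _
      rw [← rtmul_smul, Finsupp.smul_single, smul_eq_mul, mul_one, MulOpposite.op_unop]
  exact Function.LeftInverse.injective (g := σ) (DFunLike.congr_fun h)

theorem finsuppTensor_map (ι : Type*) (g : B →ₗ[R] B') (x : RTensor R (ι →₀ Rᵐᵒᵖ) B) :
    finsuppTensor R ι B' (RTensor.map R LinearMap.id g x) =
      Finsupp.mapRange.addMonoidHom g.toAddMonoidHom (finsuppTensor R ι B x) :=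
  DFunLike.congr_fun (f := (finsuppTensor R ι B').comp (RTensor.map R LinearMap.id g))
    (g := (Finsupp.mapRange.addMonoidHom g.toAddMonoidHom).comp (finsuppTensor R ι B))
    (RTensor.addHom_ext R fun v b => by
      ext i
      exact (g.map_smul (v i).unop b).symm) x

theorem finsuppTensor_map_injective (ι : Type*) {g : B →ₗ[R] B'} (hg : Function.Injective g) :
    Function.Injective
      (RTensor.map R (LinearMap.id : (ι →₀ Rᵐᵒᵖ) →ₗ[Rᵐᵒᵖ] (ι →₀ Rᵐᵒᵖ)) g) := by
  have h : Function.Injective fun x =>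
      finsuppTensor R ι B' (RTensor.map R LinearMap.id g x) := by
    simp only [finsuppTensor_map]
    exact (Finsupp.mapRange_injective _ (map_zero g.toAddMonoidHom) hg).comp
      (finsuppTensor_injective R ι B)
  exact Function.Injective.of_comp h

end TensorLemmas

/-! ### Flat modules: retracts, purity, extensions, kernels. -/

section FlatLemmas

variable (R : Type u) [Ring R]
variable {K B N : Type u} [AddCommGroup K] [Module R K] [AddCommGroup B] [Module R B]
  [AddCommGroup N] [Module R N]

theorem isFlat_finsupp (ι : Type u) : IsFlat R (ι →₀ R) := by
  intro A A' _ _ _ _ f hf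
  have h : Function.Injective fun x =>
      tensorFinsupp R ι A' (RTensor.map R f LinearMap.id x) := by
    have e : (fun x => tensorFinsupp R ι A' (RTensor.map R f LinearMap.id x)) =
        fun x => Finsupp.mapRange.addMonoidHom f.toAddMonoidHom (tensorFinsupp R ι A x) :=
      funext fun x => DFunLike.congr_fun
        (f := (tensorFinsupp R ι A').comp (RTensor.map R f LinearMap.id))
        (g := (Finsupp.mapRange.addMonoidHom f.toAddMonoidHom).comp (tensorFinsupp R ι A))
        (RTensor.addHom_ext R fun a v => by
          ext i
          exact (f.map_smul (MulOpposite.op (v i)) a).symm) x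
    rw [e]
    exact (Finsupp.mapRange_injective _ (map_zero f.toAddMonoidHom) hf).comp
      (tensorFinsupp_injective R ι A)
  exact Function.Injective.of_comp h

variable {R}

/-- A retract of a flat module is flat. -/
theorem IsFlat.of_retract (h : IsFlat R B) (i : N →ₗ[R] B) (p : B →ₗ[R] N)
    (hpi : p ∘ₗ i = LinearMap.id) : IsFlat R N := by
  intro A A' _ _ _ _ f hf
  rw [injective_iff_map_eq_zero]
  intro x hx
  have h1 : RTensor.map R LinearMap.id i x = 0 := by
    refine (injective_iff_map_eq_zero _).1 (h f hf) _ ?_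
    rw [RTensor.map_comm, hx, map_zero]
  have h2 := congrArg (RTensor.map R LinearMap.id p) h1
  rwa [RTensor.map_map, hpi, LinearMap.id_comp, RTensor.map_id, map_zero] at h2

theorem IsFlat.of_equiv (h : IsFlat R B) (e : N ≃ₗ[R] B) : IsFlat R N :=
  h.of_retract e.toLinearMap e.symm.toLinearMap (by ext; simp)

theorem isFlat_of_subsingleton [Subsingleton N] : IsFlat R N :=
  (isFlat_finsupp R PEmpty).of_retract (0 : N →ₗ[R] _) 0 (Subsingleton.elim _ _)

theorem exists_surjective_of_free (R : Type u) [Ring R] (A : Type u) [AddCommGroup A]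
    [Module Rᵐᵒᵖ A] :
    ∃ (P : Type u) (_ : AddCommGroup P) (_ : Module Rᵐᵒᵖ P) (ε : P →ₗ[Rᵐᵒᵖ] A),
      Function.Surjective ε ∧ ∀ {K B : Type u} [AddCommGroup K] [Module R K] [AddCommGroup B]
        [Module R B] (g : K →ₗ[R] B), Function.Injective g →
          Function.Injective (RTensor.map R (LinearMap.id : P →ₗ[Rᵐᵒᵖ] P) g) :=
  ⟨A →₀ Rᵐᵒᵖ, inferInstance, inferInstance, Finsupp.linearCombination Rᵐᵒᵖ id,
    Finsupp.linearCombination_id_surjective _ _,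
    fun _ hg => finsuppTensor_map_injective R A hg⟩

/-- A short exact sequence with flat right hand term is pure. -/
theorem IsFlat.pure (hN : IsFlat R N) {i : K →ₗ[R] B} {p : B →ₗ[R] N}
    (hi : Function.Injective i) (hip : Function.Exact i p) (hp : Function.Surjective p)
    (A : Type u) [AddCommGroup A] [Module Rᵐᵒᵖ A] :
    Function.Injective (RTensor.map R (LinearMap.id : A →ₗ[Rᵐᵒᵖ] A) i) := by
  obtain ⟨P, _, _, ε, hε, hP⟩ := exists_surjective_of_free R A
  have hex : Function.Exact (LinearMap.ker ε).subtype ε := LinearMap.exact_subtype_ker_map ε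
  rw [injective_iff_map_eq_zero]
  intro t ht
  obtain ⟨t, rfl⟩ := RTensor.map_surjective R hε
    (g := (LinearMap.id : K →ₗ[R] K)) Function.surjective_id t
  rw [← RTensor.map_comm] at ht
  obtain ⟨s, hs⟩ := (RTensor.exact_left R B hex hε _).1 ht
  -- Diagram chase on ker ε → P → A against K → B → N. Flatness of N makes ker ε ⊗ N → P ⊗ N
  -- injective, so s comes from ker ε ⊗ K; injectivity of P ⊗ K → P ⊗ B then identifies t with the
  -- image of that element.
  have h1 : RTensor.map R LinearMap.id p s = 0 := by
    refine (injective_iff_map_eq_zero _).1 (hN _ (LinearMap.ker ε).injective_subtype) _ ?_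
    rw [RTensor.map_comm, hs]
    exact (RTensor.exact_right R _ hip hp).apply_apply_eq_zero t
  obtain ⟨s, rfl⟩ := (RTensor.exact_right R _ hip hp _).1 h1
  rw [RTensor.map_comm] at hs
  rw [← hP i hi hs]
  exact (RTensor.exact_left R K hex hε).apply_apply_eq_zero s

theorem IsFlat.of_exact (hK : IsFlat R K) (hN : IsFlat R N) {i : K →ₗ[R] B} {p : B →ₗ[R] N}
    (hi : Function.Injective i) (hip : Function.Exact i p) (hp : Function.Surjective p) :
    IsFlat R B := by
  intro A A' _ _ _ _ f hf
  rw [injective_iff_map_eq_zero]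
  intro t ht
  have h1 : RTensor.map R LinearMap.id p t = 0 := by
    refine (injective_iff_map_eq_zero _).1 (hN f hf) _ ?_
    rw [RTensor.map_comm, ht, map_zero]
  obtain ⟨s, rfl⟩ := (RTensor.exact_right R _ hip hp _).1 h1
  rw [RTensor.map_comm] at ht
  rw [(injective_iff_map_eq_zero _).1 (hK f hf) _
    ((injective_iff_map_eq_zero _).1 (hN.pure hi hip hp A') _ ht), map_zero]

/-- By purity A ⊗ K embeds in A ⊗ B, which embeds in A' ⊗ B; this composite factors through A ⊗ K →
A' ⊗ K. -/
theorem IsFlat.of_exact_left (hB : IsFlat R B) (hN : IsFlat R N) {i : K →ₗ[R] B}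
    {p : B →ₗ[R] N} (hi : Function.Injective i) (hip : Function.Exact i p)
    (hp : Function.Surjective p) : IsFlat R K := by
  intro A A' _ _ _ _ f hf
  have h : Function.Injective fun x =>
      RTensor.map R LinearMap.id i (RTensor.map R f (LinearMap.id : K →ₗ[R] K) x) := by
    simp only [← RTensor.map_comm]
    exact (hB f hf).comp (hN.pure hi hip hp A)
  exact Function.Injective.of_comp h

/-- Factor `g` through its range: the surjective part is handled by right exactness, the inclusion
by flatness. -/
theorem IsFlat.exact {F : Type u} [AddCommGroup F] [Module R F] (hF : IsFlat R F)
    {A A' A'' : Type u} [AddCommGroup A] [Module Rᵐᵒᵖ A] [AddCommGroup A'] [Module Rᵐᵒᵖ A']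
    [AddCommGroup A''] [Module Rᵐᵒᵖ A''] {f : A →ₗ[Rᵐᵒᵖ] A'} {g : A' →ₗ[Rᵐᵒᵖ] A''}
    (h : Function.Exact f g) :
    Function.Exact (RTensor.map R f (LinearMap.id : F →ₗ[R] F))
      (RTensor.map R g (LinearMap.id : F →ₗ[R] F)) := by
  have h' : Function.Exact f g.rangeRestrict := by
    intro x
    rw [← h x]
    exact Subtype.ext_iff
  have e : ∀ x, RTensor.map R g (LinearMap.id : F →ₗ[R] F) x =
      RTensor.map R (LinearMap.range g).subtype LinearMap.id
        (RTensor.map R g.rangeRestrict LinearMap.id x) := by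
    intro x
    rw [RTensor.map_map]; rfl
  intro x
  rw [← RTensor.exact_left R F h' g.surjective_rangeRestrict x, e]
  exact map_eq_zero_iff _ (hF _ (LinearMap.range g).injective_subtype)

end FlatLemmas

/-! ### The map M^* ⊗ N → Hom(M, N). -/

section FactorThroughFree

variable (R : Type u) [Ring R]

/-- Precomposition with `g` as a map of right modules `M^* → P^*`. -/
def dualMap {M P : Type*} [AddCommGroup M] [Module R M] [AddCommGroup P] [Module R P]
    (g : P →ₗ[R] M) : (M →ₗ[R] R) →ₗ[Rᵐᵒᵖ] (P →ₗ[R] R) where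
  toFun φ := φ ∘ₗ g
  map_add' _ _ := rfl
  map_smul' _ _ := rfl

/-- The canonical map `M^* ⊗_R N → Hom_R(M, N)`. -/
def dualTensorHom (M N : Type*) [AddCommGroup M] [Module R M] [AddCommGroup N] [Module R N] :
    RTensor R (M →ₗ[R] R) N →+ (M →ₗ[R] N) :=
  RTensor.lift R
    (AddMonoidHom.mk' (fun φ => AddMonoidHom.mk' (fun n => LinearMap.toSpanSingleton R N n ∘ₗ φ)
        fun n n' => by ext; simp)
      fun φ φ' => by ext; simp [add_smul])
    fun φ r n => by ext; simp [mul_smul]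

variable {R}
variable {M N P B : Type*} [AddCommGroup M] [Module R M] [AddCommGroup N] [Module R N]
  [AddCommGroup P] [Module R P] [AddCommGroup B] [Module R B]

theorem dualTensorHom_comp (g : P →ₗ[R] M) (x : RTensor R (M →ₗ[R] R) N) :
    dualTensorHom R M N x ∘ₗ g =
      dualTensorHom R P N (RTensor.map R (dualMap R g) LinearMap.id x) := by
  induction x using RTensor.induction with
  | h0 => simp
  | ht φ n => rfl
  | ha x y hx hy => rw [map_add, map_add, map_add, LinearMap.add_comp, hx, hy]

theorem dualTensorHom_bijective (n : ℕ) :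
    Function.Bijective (dualTensorHom R (Fin n → R) N) := by
  let σ : ((Fin n → R) →ₗ[R] N) → RTensor R ((Fin n → R) →ₗ[R] R) N := fun g =>
    ∑ i, rtmul R (LinearMap.proj i) (g (Pi.single i 1))
  refine Function.bijective_iff_has_inverse.2 ⟨σ, fun x => ?_, fun g => ?_⟩
  · induction x using RTensor.induction with
    | h0 => simp [σ, rtmul_zero_right]
    | ht φ y =>
      have : φ = ∑ i, MulOpposite.op (φ (Pi.single i 1)) • LinearMap.proj i := by
        refine LinearMap.pi_ext' fun j => LinearMap.ext_ring ?_
        simp [Pi.single_apply]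
      change ∑ i, rtmul R (LinearMap.proj i) (φ (Pi.single i 1) • y) = rtmul R φ y
      conv_rhs => rw [this]
      simp only [← rtmul_smul]
      exact (map_sum (rtmulLeft R y) (fun i : Fin n => MulOpposite.op (φ (Pi.single i 1)) •
        (LinearMap.proj i : (Fin n → R) →ₗ[R] R)) Finset.univ).symm
    | ha x y hx hy =>
      have hσ : ∀ g g', σ (g + g') = σ g + σ g' := fun g g' => by
        simp only [σ, LinearMap.add_apply, rtmul_add_right, Finset.sum_add_distrib]
      rw [map_add, hσ, hx, hy]
  · simp only [σ, map_sum]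
    refine LinearMap.pi_ext' fun j => LinearMap.ext_ring ?_
    rw [LinearMap.comp_apply, LinearMap.sum_apply]
    change ∑ i, (Pi.single j (1 : R) : Fin n → R) i • g (Pi.single i 1) = g (Pi.single j 1)
    simp [Pi.single_apply]

/-- A pure tensor φ ⊗ n gives the map m ↦ φ(m) n, which lifts once n does. -/
theorem exists_lift_dualTensorHom {p : B →ₗ[R] N} (hp : Function.Surjective p)
    (x : RTensor R (M →ₗ[R] R) N) : ∃ h : M →ₗ[R] B, p ∘ₗ h = dualTensorHom R M N x := by
  induction x using RTensor.induction with
  | h0 => exact ⟨0, by simp⟩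
  | ht φ n =>
    obtain ⟨b, rfl⟩ := hp n
    refine ⟨LinearMap.toSpanSingleton R B b ∘ₗ φ, ?_⟩
    ext m
    exact p.map_smul (φ m) b
  | ha x y hx hy =>
    obtain ⟨h, hh⟩ := hx
    obtain ⟨k, hk⟩ := hy
    exact ⟨h + k, by rw [LinearMap.comp_add, hh, hk, map_add]⟩

end FactorThroughFree

/-! ### Lazard's lifting criterion and weak global dimension at most 1. -/

section Lazard

variable {R : Type u} [Ring R]

/-- Take a presentation R^m → R^n → M → 0. Its dual is exact at (R^n)^* and stays so after tensoring
with the flat module N; comparison with Hom(-, N), where the finite free terms agree, gives the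
claim. -/
theorem IsFlat.dualTensorHom_surjective {M N : Type u} [AddCommGroup M] [Module R M]
    [AddCommGroup N] [Module R N] (hN : IsFlat R N) [Module.FinitePresentation R M] :
    Function.Surjective (dualTensorHom R M N) := by
  intro f
  obtain ⟨n, m, p, g, hp, hgp⟩ := Module.FinitePresentation.exists_fin' R M
  obtain ⟨t, ht⟩ := (dualTensorHom_bijective n).2 (f ∘ₗ p)
  have h0 : RTensor.map R (dualMap R g) LinearMap.id t = 0 := by
    refine (dualTensorHom_bijective m).1 ?_
    rw [← dualTensorHom_comp, ht, map_zero, LinearMap.comp_assoc,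
      show p ∘ₗ g = 0 from LinearMap.ext hgp.apply_apply_eq_zero, LinearMap.comp_zero]
  have hex : Function.Exact (dualMap R p) (dualMap R g) := by
    intro φ
    constructor
    · intro hφ
      have hk : LinearMap.ker p ≤ LinearMap.ker φ := by
        intro x hx
        obtain ⟨y, rfl⟩ := (hgp x).1 hx
        exact LinearMap.congr_fun hφ y
      refine ⟨(LinearMap.ker p).liftQ φ hk ∘ₗ
        (p.quotKerEquivOfSurjective hp).symm.toLinearMap, ?_⟩
      ext i
      change (LinearMap.ker p).liftQ φ hk ((p.quotKerEquivOfSurjective hp).symm (p _)) = φ _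
      have : ∀ x, (p.quotKerEquivOfSurjective hp).symm (p x) = Submodule.Quotient.mk x :=
        fun x => (LinearEquiv.symm_apply_eq _).2 rfl
      rw [this]
      rfl
    · rintro ⟨φ, rfl⟩
      ext x
      change φ (p (g _)) = 0
      rw [hgp.apply_apply_eq_zero, map_zero]
  obtain ⟨x, rfl⟩ := (hN.exact hex t).1 h0
  refine ⟨x, ?_⟩
  rw [← dualTensorHom_comp] at ht
  ext y
  obtain ⟨y, rfl⟩ := hp y
  exact LinearMap.congr_fun ht y

theorem IsFlat.exists_lift {M N B : Type u} [AddCommGroup M] [Module R M]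
    [AddCommGroup N] [Module R N] [AddCommGroup B] [Module R B]
    (hN : IsFlat R N) [Module.FinitePresentation R M] {p : B →ₗ[R] N}
    (hp : Function.Surjective p) (f : M →ₗ[R] N) : ∃ h : M →ₗ[R] B, p ∘ₗ h = f := by
  obtain ⟨x, rfl⟩ := hN.dualTensorHom_surjective f
  exact exists_lift_dualTensorHom hp x

/-- If morphisms from finitely presented modules to `N` lift through the free cover of `N`, then
finitely many elements of the kernel of that cover are fixed by an endomorphism of the cover with
values in the kernel. -/
theorem exists_endomorphism_of_lifts {N : Type u} [AddCommGroup N] [Module R N]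
    (h : ∀ (M : Type u) [AddCommGroup M] [Module R M] [Module.FinitePresentation R M]
      (f : M →ₗ[R] N), ∃ k : M →ₗ[R] (N →₀ R), Finsupp.linearCombination R id ∘ₗ k = f)
    (T : Finset (N →₀ R)) (hT : ∀ k ∈ T, Finsupp.linearCombination R (id : N → N) k = 0) :
    ∃ θ : (N →₀ R) →ₗ[R] (N →₀ R),
      (Finsupp.linearCombination R (id : N → N)) ∘ₗ θ = 0 ∧ ∀ k ∈ T, θ k = k := by
  classical
  let π : (N →₀ R) →ₗ[R] N := Finsupp.linearCombination R id
  -- The elements of `T` lie in the finite free summand on `S`. Dividing it by their span gives a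
  -- finitely presented module that maps to N, and the lift `k` of this map corrects the inclusion
  -- `ι` so that it takes values in the kernel.
  let S : Finset N := T.biUnion Finsupp.support
  let ι : (S →₀ R) →ₗ[R] (N →₀ R) := Finsupp.lmapDomain R R Subtype.val
  let ρ : (N →₀ R) →ₗ[R] (S →₀ R) := Finsupp.lcomapDomain Subtype.val Subtype.val_injective
  have hιρ : ∀ k ∈ T, ι (ρ k) = k := fun k hk =>
    Finsupp.mapDomain_comapDomain _ Subtype.val_injective _ fun x hx =>
      ⟨⟨x, Finset.mem_biUnion.2 ⟨k, hk, hx⟩⟩, rfl⟩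
  let K : Submodule R (S →₀ R) := Submodule.span R (T.image ρ)
  have hK : K ≤ LinearMap.ker (π ∘ₗ ι) := by
    rw [Submodule.span_le]
    intro x hx
    obtain ⟨k, hk, rfl⟩ := Finset.mem_image.1 (Finset.mem_coe.1 hx)
    change π (ι (ρ k)) = 0
    rw [hιρ k hk]
    exact hT k hk
  have : Module.FinitePresentation R ((S →₀ R) ⧸ K) :=
    Module.finitePresentation_of_free_of_surjective K.mkQ K.mkQ_surjective
      (by rw [K.ker_mkQ]; exact ⟨_, rfl⟩)
  obtain ⟨k, hk⟩ := h _ (K.liftQ _ hK)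
  refine ⟨(ι - k ∘ₗ K.mkQ) ∘ₗ ρ, ?_, fun x hx => ?_⟩
  · ext n
    have := LinearMap.congr_fun hk (K.mkQ (ρ (Finsupp.single n 1)))
    change π (ι (ρ (Finsupp.single n 1)) - k (K.mkQ (ρ (Finsupp.single n 1)))) = 0
    rw [map_sub, sub_eq_zero]
    exact this.symm
  · have : K.mkQ (ρ x) = 0 := by
      rw [Submodule.mkQ_apply, Submodule.Quotient.mk_eq_zero]
      exact Submodule.subset_span (Finset.mem_coe.2 (Finset.mem_image_of_mem ρ hx))
    change ι (ρ x) - k (K.mkQ (ρ x)) = x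
    rw [this, map_zero, sub_zero, hιρ x hx]

/-- Finitely many elements suffice to write an element of `A ⊗_R B`. -/
theorem exists_finset_forall_map_eq {A B B' : Type*} [AddCommGroup A] [Module Rᵐᵒᵖ A]
    [AddCommGroup B] [Module R B] [AddCommGroup B'] [Module R B'] (x : RTensor R A B) :
    ∃ T : Finset B, ∀ g g' : B →ₗ[R] B', (∀ b ∈ T, g b = g' b) →
      RTensor.map R (LinearMap.id : A →ₗ[Rᵐᵒᵖ] A) g x = RTensor.map R LinearMap.id g' x := by
  classical
  induction x using RTensor.induction with
  | h0 => exact ⟨∅, fun g g' _ => by rw [map_zero, map_zero]⟩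
  | ht a b =>
    refine ⟨{b}, fun g g' h => ?_⟩
    rw [RTensor.map_rtmul, RTensor.map_rtmul, h b (Finset.mem_singleton_self b)]
  | ha x y hx hy =>
    obtain ⟨S, hS⟩ := hx
    obtain ⟨T, hT⟩ := hy
    refine ⟨S ∪ T, fun g g' h => ?_⟩
    rw [map_add, map_add, hS g g' fun b hb => h b (Finset.mem_union_left _ hb),
      hT g g' fun b hb => h b (Finset.mem_union_right _ hb)]

/-- An element of A ⊗ N is lifted to t in A ⊗ B. If it dies in A' ⊗ N, then the image of t in A' ⊗ B
involves finitely many kernel elements, so some θ fixes it. Flatness of B gives θ t = t, and π θ = 0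
kills the image of t in A ⊗ N. -/
theorem IsFlat.of_endomorphisms {B N : Type u} [AddCommGroup B] [Module R B] [AddCommGroup N]
    [Module R N] (hB : IsFlat R B) {π : B →ₗ[R] N} (hπ : Function.Surjective π)
    (h : ∀ T : Finset B, (∀ k ∈ T, π k = 0) → ∃ θ : B →ₗ[R] B, π ∘ₗ θ = 0 ∧ ∀ k ∈ T, θ k = k) :
    IsFlat R N := by
  classical
  intro A A' _ _ _ _ f hf
  have hex : Function.Exact (LinearMap.ker π).subtype π := LinearMap.exact_subtype_ker_map π
  rw [injective_iff_map_eq_zero]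
  intro t ht
  obtain ⟨t, rfl⟩ := RTensor.map_surjective R (f := (LinearMap.id : A →ₗ[Rᵐᵒᵖ] A))
    Function.surjective_id hπ t
  rw [RTensor.map_comm] at ht
  obtain ⟨s, hs⟩ := (RTensor.exact_right R A' hex hπ _).1 ht
  obtain ⟨T, hT⟩ := exists_finset_forall_map_eq (B' := B) s
  obtain ⟨θ, hθ, hθT⟩ := h (T.image Subtype.val) (by
    intro k hk
    obtain ⟨k, -, rfl⟩ := Finset.mem_image.1 hk
    exact k.2)
  have h1 : RTensor.map R LinearMap.id θ t = t := by
    refine hB f hf ?_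
    rw [RTensor.map_comm, ← hs, RTensor.map_map]
    exact hT _ _ fun b hb => hθT _ (Finset.mem_image_of_mem _ hb)
  rw [← h1, RTensor.map_map, hθ, RTensor.map_zero_right]

theorem isFlat_of_lifts {N : Type u} [AddCommGroup N] [Module R N]
    (h : ∀ (M : Type u) [AddCommGroup M] [Module R M] [Module.FinitePresentation R M]
      (f : M →ₗ[R] N), ∃ k : M →ₗ[R] (N →₀ R), Finsupp.linearCombination R id ∘ₗ k = f) :
    IsFlat R N :=
  (isFlat_finsupp R N).of_endomorphisms (Finsupp.linearCombination_id_surjective _ _)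
    (exists_endomorphism_of_lifts h)

/-- All submodules of flat modules are flat. -/
def SubmodulesOfFlatAreFlat (R : Type u) [Ring R] : Prop :=
  ∀ (F : Type u) [AddCommGroup F] [Module R F], IsFlat R F → ∀ L : Submodule R F, IsFlat R L

theorem hasFlatDimensionLE_one_of_flatDimension_le_one {M : ModuleCat.{u} R}
    (h : flatDimension R M ≤ 1) : HasFlatDimensionLE R 1 M := by
  by_contra hM
  have h2 : (2 : ℕ∞) ≤ flatDimension R M := by
    refine le_iInf₂ fun n hn => ?_
    match n, hn with
    | 0, hn =>
      -- A flat M also has the length-one resolution 0 → 0 → M → M → 0.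
      exact absurd ⟨ModuleCat.of R PUnit, M, (0 : PUnit.{u + 1} →ₗ[R] M), LinearMap.id,
        Function.injective_of_subsingleton _,
        fun x => ⟨fun hx => ⟨0, hx.symm⟩, fun ⟨_, hx⟩ => hx.symm⟩,
        Function.surjective_id, hn, isFlat_of_subsingleton⟩ hM
    | 1, hn => exact absurd hn hM
    | n + 2, _ => exact_mod_cast Nat.le_add_left 2 n
  exact absurd (h2.trans h) (by decide)

theorem weakGlobalDimension_le_one_iff :
    weakGlobalDimension R ≤ 1 ↔ SubmodulesOfFlatAreFlat R := by
  constructor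
  · intro h F _ _ hF L
    obtain ⟨K, G, i, p, hi, hip, hp, hG, hK⟩ :=
      hasFlatDimensionLE_one_of_flatDimension_le_one
        ((le_iSup (flatDimension R) (ModuleCat.of R (F ⧸ L))).trans h)
    -- the pullback of `G → F ⧸ L ← F`
    let p' : G →ₗ[R] F ⧸ L := p
    let Q : Submodule R (F × G) :=
      LinearMap.eqLocus (L.mkQ ∘ₗ LinearMap.fst R F G) (p' ∘ₗ LinearMap.snd R F G)
    have hQ : ∀ {x : F} {y : G}, (x, y) ∈ Q ↔ L.mkQ x = p' y := Iff.rfl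
    -- The first projection makes Q an extension of F by K.
    have hQF : IsFlat R Q := by
      let j : K →ₗ[R] Q := LinearMap.codRestrict Q (LinearMap.inr R F G ∘ₗ i) fun k =>
        hQ.2 ((map_zero _).trans (hip.apply_apply_eq_zero k).symm)
      refine IsFlat.of_exact hK hF (i := j) (p := LinearMap.fst R F G ∘ₗ Q.subtype)
        (fun a b hab => hi (congrArg (fun x : Q => x.1.2) hab)) ?_ ?_
      · rintro ⟨⟨x, y⟩, hxy⟩
        constructor
        · intro hx
          obtain rfl : x = 0 := hx
          obtain ⟨k, rfl⟩ := (hip y).1 (((map_zero _).symm.trans (hQ.1 hxy)).symm)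
          exact ⟨k, rfl⟩
        · rintro ⟨k, hk⟩
          exact (congrArg (fun x : Q => x.1.1) hk).symm
      · intro x
        obtain ⟨y, hy⟩ := hp (L.mkQ x)
        exact ⟨⟨(x, y), hQ.2 hy.symm⟩, rfl⟩
    -- The second projection exhibits L as the kernel of Q → G.
    let j : L →ₗ[R] Q := LinearMap.codRestrict Q (LinearMap.inl R F G ∘ₗ L.subtype) fun k =>
      hQ.2 (((Submodule.Quotient.mk_eq_zero L).2 k.2).trans (map_zero p').symm)
    refine IsFlat.of_exact_left hQF hG (i := j) (p := LinearMap.snd R F G ∘ₗ Q.subtype)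
        (fun a b hab => Subtype.ext (congrArg (fun x : Q => x.1.1) hab)) ?_ ?_
    · rintro ⟨⟨x, y⟩, hxy⟩
      constructor
      · intro hy
        obtain rfl : y = 0 := hy
        have : L.mkQ x = 0 := (hQ.1 hxy).trans (map_zero p')
        exact ⟨⟨x, (Submodule.Quotient.mk_eq_zero L).1 this⟩, rfl⟩
      · rintro ⟨k, hk⟩
        exact (congrArg (fun x : Q => x.1.2) hk).symm
    · intro y
      obtain ⟨x, hx⟩ := L.mkQ_surjective (p' y)
      exact ⟨⟨(x, y), hQ.2 hx⟩, rfl⟩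
  · intro h
    refine iSup_le fun M => iInf₂_le_of_le 1 ?_ le_rfl
    let π : (M →₀ R) →ₗ[R] M := Finsupp.linearCombination R id
    exact ⟨ModuleCat.of R (LinearMap.ker π), ModuleCat.of R (M →₀ R),
      (LinearMap.ker π).subtype, π, Subtype.val_injective, LinearMap.exact_subtype_ker_map π,
      Finsupp.linearCombination_id_surjective _ _, isFlat_finsupp R M,
      h _ (isFlat_finsupp R M) _⟩

end Lazard

/-! ### Exactness and epimorphisms of complexes, elementwise. -/

section ComplexLemmas

theorem acyclic_iff_exact {S : Type*} [Ring S] (N : ChainComplex (ModuleCat S) ℤ) :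
    N.Acyclic ↔ ∀ i j k : ℤ, j + 1 = i → k + 1 = j →
      Function.Exact (N.d i j).hom (N.d j k).hom := by
  constructor
  · intro h i j k hij hjk
    have := (N.exactAt_iff' i j k ((ComplexShape.down ℤ).prev_eq' hij)
      ((ComplexShape.down ℤ).next_eq' hjk)).1 (h j)
    exact (ShortComplex.ShortExact.moduleCat_exact_iff_function_exact _).1 this
  · intro h j
    refine (N.exactAt_iff' (j + 1) j (j - 1) ((ComplexShape.down ℤ).prev_eq' rfl)
      ((ComplexShape.down ℤ).next_eq' (sub_add_cancel j 1))).2 ?_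
    exact (ShortComplex.ShortExact.moduleCat_exact_iff_function_exact _).2
      (h _ _ _ rfl (sub_add_cancel j 1))

variable {R : Type u} [Ring R]

theorem epi_of_surjective {K L : ChainComplex (ModuleCat.{u} R) ℤ} (g : K ⟶ L)
    (h : ∀ n, Function.Surjective (g.f n)) : Epi g := by
  have : ∀ n, Epi (g.f n) := fun n => (ModuleCat.epi_iff_surjective _).2 (h n)
  exact HomologicalComplex.epi_of_epi_f g this

theorem surjective_of_epi {K L : ChainComplex (ModuleCat.{u} R) ℤ} (g : K ⟶ L) [Epi g] (n : ℤ) :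
    Function.Surjective (g.f n) :=
  (ModuleCat.epi_iff_surjective _).1 inferInstance

end ComplexLemmas

/-! ### Covering a complex by discs on free modules. -/

section DiscCover

variable {R : Type u} [Ring R] (B : ChainComplex (ModuleCat.{u} R) ℤ)

/-- The sum over `n` of the discs on the free modules on `B_n`: a contractible complex of free
modules which covers `B`. -/
noncomputable def discCover : ChainComplex (ModuleCat.{u} R) ℤ :=
  ChainComplex.of (fun n => ModuleCat.of R ((B.X n →₀ R) × (B.X (n + 1) →₀ R)))
    (fun _ => ModuleCat.ofHom (LinearMap.inr R _ _ ∘ₗ LinearMap.fst R _ _))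
    (fun _ => by ext <;> simp)

theorem discCover_d (n : ℤ) (x : (B.X (n + 1) →₀ R)) (y : (B.X (n + 1 + 1) →₀ R)) :
    ((discCover B).d (n + 1) n).hom (x, y) = ((0 : B.X n →₀ R), x) := by
  have : (discCover B).d (n + 1) n =
      ModuleCat.ofHom (LinearMap.inr R _ _ ∘ₗ LinearMap.fst R _ _) := by
    simp only [discCover, ChainComplex.of_d]
  rw [this]
  rfl

theorem discCover_acyclic : (discCover B).Acyclic := by
  rw [acyclic_iff_exact]
  rintro _ _ k rfl rfl ⟨x, y⟩
  constructor
  · intro h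
    rw [discCover_d] at h
    obtain rfl : x = 0 := congrArg Prod.snd h
    exact ⟨(y, 0), discCover_d B (k + 1) y 0⟩
  · rintro ⟨⟨x', y'⟩, h⟩
    rw [discCover_d] at h
    obtain rfl : 0 = x := congrArg Prod.fst h
    exact discCover_d B k 0 y

theorem discCover_isFlat (n : ℤ) : IsFlat R ((discCover B).X n) := by
  refine IsFlat.of_exact (isFlat_finsupp R (B.X n)) (isFlat_finsupp R (B.X (n + 1)))
    (i := LinearMap.inl R (B.X n →₀ R) (B.X (n + 1) →₀ R)) (p := LinearMap.snd R _ _)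
    LinearMap.inl_injective ?_ LinearMap.snd_surjective
  exact Function.Exact.inl_snd

/-- The cover of `M` by the free module on its elements. -/
noncomputable def freeCover (M : Type u) [AddCommGroup M] [Module R M] : (M →₀ R) →ₗ[R] M :=
  Finsupp.linearCombination R id

theorem freeCover_surjective (M : Type u) [AddCommGroup M] [Module R M] :
    Function.Surjective (freeCover (R := R) M) :=
  Finsupp.linearCombination_id_surjective _ _

/-- The epimorphism from `discCover B` to `B`. -/
noncomputable def discCoverπ : discCover B ⟶ B :=
  ChainComplex.ofHom (fun n => ModuleCat.ofHom ((freeCover (B.X n)).coprod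
    ((B.d (n + 1) n).hom ∘ₗ freeCover (B.X (n + 1))))) (fun n => by
      refine ModuleCat.hom_ext (LinearMap.ext ?_)
      rintro ⟨x, y⟩
      change (B.d (n + 1) n).hom (freeCover _ x + (B.d (n + 1 + 1) (n + 1)).hom (freeCover _ y)) =
        (LinearMap.coprod (freeCover (B.X n)) ((B.d (n + 1) n).hom ∘ₗ freeCover (B.X (n + 1))))
          (((discCover B).d (n + 1) n).hom (x, y))
      have h : (B.d (n + 1) n).hom ((B.d (n + 1 + 1) (n + 1)).hom (freeCover _ y)) = 0 := by
        rw [← LinearMap.comp_apply, ← ModuleCat.hom_comp, B.d_comp_d]; rfl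
      rw [discCover_d, map_add, h, LinearMap.coprod_apply, map_zero, zero_add, add_zero]
      rfl)

theorem discCoverπ_f (n : ℤ) (x : B.X n →₀ R) (y : B.X (n + 1) →₀ R) :
    ((discCoverπ B).f n).hom (x, y) =
      freeCover _ x + (B.d (n + 1) n).hom (freeCover _ y) := rfl

theorem discCoverπ_surjective (n : ℤ) : Function.Surjective ((discCoverπ B).f n) := by
  intro b
  obtain ⟨x, rfl⟩ := freeCover_surjective (R := R) _ b
  exact ⟨(x, 0), by rw [discCoverπ_f, map_zero, map_zero, add_zero]⟩

/-- The projection of `discCover B` in degree `n` to the free module on `B_{n+1}`. -/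
noncomputable def discCoverSnd (n : ℤ) : (discCover B).X n →ₗ[R] (B.X (n + 1) →₀ R) :=
  LinearMap.snd R (B.X n →₀ R) (B.X (n + 1) →₀ R)

/-- A cycle of the disc cover has zero first component. Maps into the cycles therefore reach B
through the free module on B_{n+1}. -/
theorem discCoverπ_f_of_d_eq_zero {n m : ℤ} (h : m + 1 = n) (z : (discCover B).X n)
    (hz : ((discCover B).d n m).hom z = 0) :
    ((discCoverπ B).f n).hom z = (B.d (n + 1) n).hom (freeCover _ (discCoverSnd B n z)) := by
  subst h
  obtain ⟨a, b⟩ := z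
  rw [discCover_d] at hz
  obtain rfl : a = 0 := congrArg Prod.snd hz
  rw [discCoverπ_f, map_zero, zero_add]
  rfl

end DiscCover

/-! ### Lifting chain maps: from assertion 1 to 2 and from 2 to 3. -/

section Lifting

variable {R : Type u} [Ring R]

theorem d_d_apply (K : ChainComplex (ModuleCat.{u} R) ℤ) (i j k : ℤ) (x : K.X i) :
    (K.d j k).hom ((K.d i j).hom x) = 0 := by
  rw [← LinearMap.comp_apply, ← ModuleCat.hom_comp, K.d_comp_d]; rfl

theorem f_d_apply {K L : ChainComplex (ModuleCat.{u} R) ℤ} (g : K ⟶ L) (i j : ℤ) (x : K.X i) :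
    (g.f j).hom ((K.d i j).hom x) = (L.d i j).hom ((g.f i).hom x) := by
  rw [← LinearMap.comp_apply, ← LinearMap.comp_apply, ← ModuleCat.hom_comp, ← ModuleCat.hom_comp,
    g.comm]

/-- One step in the construction of a lift of a chain map along `g`. -/
theorem exists_lift_step (hS : SubmodulesOfFlatAreFlat R)
    {M N P : ChainComplex (ModuleCat.{u} R) ℤ} (g : P ⟶ N)
    (hg : ∀ n, Function.Surjective (g.f n)) (hPf : ∀ n, IsFlat R (P.X n)) (hP : P.Acyclic)
    (hN : N.Acyclic) (f : M ⟶ N) (m : ℤ) [Module.FinitePresentation R (M.X m)]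
    (hM : N.X m ∈ subprojectivityDomain (M.X m)) (h : M.X (m - 1) →ₗ[R] P.X (m - 1))
    (h' : M.X (m - 1 - 1) →ₗ[R] P.X (m - 1 - 1))
    (hd : ∀ x, (P.d (m - 1) (m - 1 - 1)).hom (h x) = h' ((M.d (m - 1) (m - 1 - 1)).hom x))
    (hf : ∀ x, (g.f (m - 1)).hom (h x) = (f.f (m - 1)).hom x) :
    ∃ k : M.X m →ₗ[R] P.X m, (∀ x, (P.d m (m - 1)).hom (k x) = h ((M.d m (m - 1)).hom x)) ∧
      ∀ x, (g.f m).hom (k x) = (f.f m).hom x := by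
  rw [acyclic_iff_exact] at hP hN
  have hge : Epi (g.f m) := (ModuleCat.epi_iff_surjective _).2 (hg m)
  obtain ⟨u, hu⟩ := hM (g.f m) (f.f m)
  have hu' : ∀ x, (g.f m).hom (u.hom x) = (f.f m).hom x := fun x => by
    rw [← hu]; rfl
  -- `Z` is the module of cycles of ker g in degree m - 1, flat as a submodule of P_{m-1}; `w` is
  -- the defect of the degreewise lift `u`.
  let Z : Submodule R (P.X (m - 1)) :=
    LinearMap.ker (P.d (m - 1) (m - 1 - 1)).hom ⊓ LinearMap.ker (g.f (m - 1)).hom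
  let K : Submodule R (P.X m) := LinearMap.ker (g.f m).hom
  let w : M.X m →ₗ[R] Z := LinearMap.codRestrict Z
    (h ∘ₗ (M.d m (m - 1)).hom - (P.d m (m - 1)).hom ∘ₗ u.hom) fun x => by
      constructor
      · change (P.d (m - 1) (m - 1 - 1)).hom (h ((M.d m (m - 1)).hom x) -
          (P.d m (m - 1)).hom (u.hom x)) = 0
        rw [map_sub, hd, d_d_apply, d_d_apply, map_zero, sub_zero]
      · change (g.f (m - 1)).hom (h ((M.d m (m - 1)).hom x) -
          (P.d m (m - 1)).hom (u.hom x)) = 0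
        rw [map_sub, hf, f_d_apply, f_d_apply, hu', sub_self]
  let q : K →ₗ[R] Z := LinearMap.codRestrict Z ((P.d m (m - 1)).hom ∘ₗ K.subtype) fun x => by
    constructor
    · exact d_d_apply P _ _ _ _
    · change (g.f (m - 1)).hom ((P.d m (m - 1)).hom x) = 0
      rw [f_d_apply, show (g.f m).hom x.1 = 0 from x.2, map_zero]
  -- Exactness of ker g: write z = d y; then g y is a cycle of N, hence a boundary d n. Lifting n to
  -- v, the element y - d v lies in ker g and still has boundary z.
  have hq : Function.Surjective q := by
    rintro ⟨z, hz1, hz2⟩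
    obtain ⟨y, rfl⟩ := (hP m (m - 1) (m - 1 - 1) (by omega) (by omega) z).1 hz1
    have h0 : (N.d m (m - 1)).hom ((g.f m).hom y) = 0 := by
      rw [← f_d_apply]; exact hz2
    obtain ⟨n, hn⟩ := (hN (m + 1) m (m - 1) rfl (by omega) _).1 h0
    obtain ⟨v, rfl⟩ := hg _ n
    refine ⟨⟨y - (P.d (m + 1) m).hom v, ?_⟩, Subtype.ext ?_⟩
    · change (g.f m).hom _ = 0
      rw [map_sub, f_d_apply, sub_eq_zero]
      exact hn.symm
    · change (P.d m (m - 1)).hom (y - (P.d (m + 1) m).hom v) = _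
      rw [map_sub, d_d_apply, sub_zero]
  obtain ⟨s, hs⟩ := (hS _ (hPf (m - 1)) Z).exists_lift hq w
  refine ⟨u.hom + K.subtype ∘ₗ s, fun x => ?_, fun x => ?_⟩
  · have : (P.d m (m - 1)).hom (s x).1 =
        h ((M.d m (m - 1)).hom x) - (P.d m (m - 1)).hom (u.hom x) :=
      congrArg Subtype.val (LinearMap.congr_fun hs x)
    change (P.d m (m - 1)).hom (u.hom x + (s x).1) = _
    rw [map_add, this, add_sub_cancel]
  · change (g.f m).hom (u.hom x + (s x).1) = _
    rw [map_add, hu', show (g.f m).hom (s x).1 = 0 from (s x).2, add_zero]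

theorem exists_lift_of_submodulesOfFlatAreFlat (hS : SubmodulesOfFlatAreFlat R)
    {M N P : ChainComplex (ModuleCat.{u} R) ℤ} (g : P ⟶ N)
    (hg : ∀ n, Function.Surjective (g.f n)) (hPf : ∀ n, IsFlat R (P.X n)) (hP : P.Acyclic)
    (hN : N.Acyclic) (hM : IsFinitelyPresentedComplex M)
    (hMN : ∀ n, N.X n ∈ subprojectivityDomain (M.X n)) (f : M ⟶ N) :
    ∃ h : M ⟶ P, h ≫ g = f := by
  obtain ⟨⟨a, b, hab⟩, hfp⟩ := hM
  -- Partial lifts that are correct in all degrees below m. For m = a zero works, since M vanishes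
  -- below a.
  have key : ∀ m, a ≤ m → ∃ h : ∀ n, M.X n →ₗ[R] P.X n, ∀ n < m,
      (∀ x, (P.d n (n - 1)).hom (h n x) = h (n - 1) ((M.d n (n - 1)).hom x)) ∧
      ∀ x, (g.f n).hom (h n x) = (f.f n).hom x := by
    intro m hm
    induction m, hm using Int.leInduction with
    | base =>
      refine ⟨fun _ => 0, fun n hn => ?_⟩
      have := ModuleCat.subsingleton_of_isZero (hab n (Or.inl hn))
      exact ⟨fun x => map_zero _, fun x => by
        rw [Subsingleton.elim x 0, map_zero, map_zero, map_zero]⟩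
    | succ m _ ih =>
      obtain ⟨h, hh⟩ := ih
      have := hfp m
      obtain ⟨k, hk1, hk2⟩ := exists_lift_step hS g hg hPf hP hN f m (hMN m) (h (m - 1))
        (h (m - 1 - 1)) (hh (m - 1) (by omega)).1 (hh (m - 1) (by omega)).2
      refine ⟨Function.update h m k, fun n hn => ?_⟩
      obtain rfl | hne := eq_or_ne n m
      · rw [Function.update_self, Function.update_of_ne (by omega)]
        exact ⟨hk1, hk2⟩
      · rw [Function.update_of_ne hne, Function.update_of_ne (by omega)]
        exact hh n (by omega)
  -- Above b the conditions hold trivially. The maximum covers the case b + 1 < a, as the induction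
  -- starts at a.
  obtain ⟨h, hh⟩ := key (max a (b + 1)) (le_max_left _ _)
  have hh' : ∀ n, (∀ x, (P.d n (n - 1)).hom (h n x) = h (n - 1) ((M.d n (n - 1)).hom x)) ∧
      ∀ x, (g.f n).hom (h n x) = (f.f n).hom x := by
    intro n
    by_cases hn : n < max a (b + 1)
    · exact hh n hn
    · have := ModuleCat.subsingleton_of_isZero (hab n (Or.inr (by omega)))
      constructor
      · intro x
        rw [Subsingleton.elim x 0]; simp only [map_zero]
      · intro x
        rw [Subsingleton.elim x 0]; simp only [map_zero]
  refine ⟨{ f := fun n => ModuleCat.ofHom (h n), comm' := ?_ }, ?_⟩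
  · intro i j hij
    obtain rfl : j = i - 1 := eq_sub_of_add_eq hij
    exact ModuleCat.hom_ext (LinearMap.ext (hh' i).1)
  · ext n x
    exact (hh' n).2 x

/-- The given B need be neither exact nor flat, so the lift is made to its disc cover and pushed
down to B. -/
theorem mem_subprojectivityDomain_of_submodulesOfFlatAreFlat (hS : SubmodulesOfFlatAreFlat R)
    {M N : ChainComplex (ModuleCat.{u} R) ℤ} (hM : IsFinitelyPresentedComplex M)
    (hN : N.Acyclic) (hMN : ∀ n, N.X n ∈ subprojectivityDomain (M.X n)) :
    N ∈ subprojectivityDomain M := by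
  intro B g _ f
  obtain ⟨h, hh⟩ := exists_lift_of_submodulesOfFlatAreFlat hS (discCoverπ B ≫ g)
    (fun n => (surjective_of_epi g n).comp (discCoverπ_surjective B n)) (discCover_isFlat B)
    (discCover_acyclic B) hN hM hMN f
  exact ⟨h ≫ discCoverπ B, by rw [Category.assoc, hh]⟩

theorem isFinitelyPresentedComplex_shiftedSphere (M : ModuleCat.{u} R)
    [hM : Module.FinitePresentation R M] (n : ℤ) :
    IsFinitelyPresentedComplex (shiftedSphere M n) := by
  have h0 : ∀ m, m ≠ n → Limits.IsZero ((shiftedSphere M n).X m) := fun m hm =>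
    HomologicalComplex.isZero_single_obj_X _ _ _ _ hm
  refine ⟨⟨n, n, fun m hm => h0 m (by omega)⟩, fun m => ?_⟩
  obtain rfl | hne := eq_or_ne m n
  · exact Module.FinitePresentation.of_equiv
      (HomologicalComplex.singleObjXSelf (ComplexShape.down ℤ) m M).symm.toLinearEquiv
  · have := ModuleCat.subsingleton_of_isZero (h0 m hne)
    infer_instance

theorem mem_subprojectivityDomain_of_iso {C : Type*} [Category C] {M M' N : C} (e : M' ≅ M)
    (h : N ∈ subprojectivityDomain M) : N ∈ subprojectivityDomain M' := by
  intro B g _ f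
  obtain ⟨k, hk⟩ := h g (e.inv ≫ f)
  exact ⟨e.hom ≫ k, by rw [Category.assoc, hk, e.hom_inv_id_assoc]⟩

theorem mem_subprojectivityDomain_shiftedSphere_X {M : ModuleCat.{u} R} {n : ℤ}
    {N : ChainComplex (ModuleCat.{u} R) ℤ} (h : N.X n ∈ subprojectivityDomain M) (m : ℤ) :
    N.X m ∈ subprojectivityDomain ((shiftedSphere M n).X m) := by
  obtain rfl | hne := eq_or_ne m n
  · exact mem_subprojectivityDomain_of_iso (HomologicalComplex.singleObjXSelf _ _ _) h
  · intro B g _ f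
    exact ⟨0, (HomologicalComplex.isZero_single_obj_X _ _ _ _ hne).eq_of_src _ _⟩

end Lifting

/-! ### The complex 0 → L → F → F/L → 0: from assertion 3 to 1. -/

section Filtration

variable {R : Type u} [Ring R] {F : Type u} [AddCommGroup F] [Module R F]

/-- The acyclic complex `A_n / A_{n+2}` attached to a decreasing filtration `A`. -/
noncomputable def filtrationComplex (A : ℤ → Submodule R F) (hA : Antitone A) :
    ChainComplex (ModuleCat.{u} R) ℤ :=
  ChainComplex.of (fun n => ModuleCat.of R (A n ⧸ (A (n + 2)).submoduleOf (A n)))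
    (fun n => ModuleCat.ofHom (Submodule.mapQ _ _
      (Submodule.inclusion (hA (Int.le_add_one le_rfl)))
      fun _ hx => hA (by omega : n + 2 ≤ n + 1 + 2) hx))
    (fun n => by
      refine ModuleCat.hom_ext (LinearMap.ext fun x => ?_)
      obtain ⟨x, rfl⟩ := Submodule.Quotient.mk_surjective _ x
      refine (Submodule.Quotient.mk_eq_zero _).2 ?_
      have h : n + 1 + 1 = n + 2 := by omega
      exact h ▸ x.2)

theorem filtrationComplex_d (A : ℤ → Submodule R F) (hA : Antitone A) (n : ℤ) (x : A (n + 1)) :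
    ((filtrationComplex A hA).d (n + 1) n).hom (Submodule.Quotient.mk x) =
      Submodule.Quotient.mk (Submodule.inclusion (hA (Int.le_add_one le_rfl)) x) := by
  have : (filtrationComplex A hA).d (n + 1) n = ModuleCat.ofHom (Submodule.mapQ _ _
      (Submodule.inclusion (hA (Int.le_add_one le_rfl)))
      fun _ hx => hA (by omega : n + 2 ≤ n + 1 + 2) hx) := by
    simp only [filtrationComplex, ChainComplex.of_d]
  rw [this]
  rfl

theorem filtrationComplex_acyclic (A : ℤ → Submodule R F) (hA : Antitone A) :
    (filtrationComplex A hA).Acyclic := by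
  rw [acyclic_iff_exact]
  rintro _ _ k rfl rfl x
  constructor
  · intro h
    obtain ⟨x, rfl⟩ := Submodule.Quotient.mk_surjective _ x
    rw [filtrationComplex_d] at h
    have hx : x.1 ∈ A (k + 2) := (Submodule.Quotient.mk_eq_zero ((A (k + 2)).submoduleOf (A k))).1 h
    have e : k + 1 + 1 = k + 2 := by omega
    exact ⟨Submodule.Quotient.mk ⟨x.1, e ▸ hx⟩, filtrationComplex_d A hA (k + 1) _⟩
  · rintro ⟨y, rfl⟩
    exact d_d_apply _ _ _ _ _

/-- The filtration `F ⊇ L ⊇ 0`. -/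
def twoStepFiltration (L : Submodule R F) (n : ℤ) : Submodule R F :=
  if n ≤ 0 then ⊤ else if n ≤ 1 then L else ⊥

theorem twoStepFiltration_antitone (L : Submodule R F) : Antitone (twoStepFiltration L) := by
  intro m n h
  unfold twoStepFiltration
  split_ifs <;> first | omega | exact le_rfl | exact le_top | exact bot_le

theorem isFlat_of_forall_shiftedSphere (hF : IsFlat R F) (L : Submodule R F)
    (h : ∀ (M : ModuleCat.{u} R) (N : ChainComplex (ModuleCat.{u} R) ℤ),
      Module.FinitePresentation R M → N.Acyclic → ∀ n : ℤ, N.X n ∈ subprojectivityDomain M →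
        N ∈ subprojectivityDomain (shiftedSphere M n)) :
    IsFlat R L := by
  let A := twoStepFiltration L
  let N := filtrationComplex A (twoStepFiltration_antitone L)
  have hN : N.Acyclic := filtrationComplex_acyclic _ _
  -- The filtration vanishes from index 2 on, so N_0 is F and N_1 is L. The index `0 + 1` matches
  -- the form used in `filtrationComplex_d`.
  have hA2 : A (0 + 2) = ⊥ := rfl
  have hA3 : A (0 + 1 + 2) = ⊥ := rfl
  have hK0 : (A (0 + 2)).submoduleOf (A 0) = ⊥ := by
    rw [hA2, Submodule.submoduleOf, Submodule.comap_bot, Submodule.ker_subtype]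
  have hN0 : IsFlat R (N.X 0) := by
    refine hF.of_equiv ?_
    exact (Submodule.quotEquivOfEqBot _ hK0).trans Submodule.topEquiv
  have hA1 : A (0 + 1) = L := rfl
  have hK1 : (A (0 + 1 + 2)).submoduleOf (A (0 + 1)) = ⊥ := by
    rw [hA3, Submodule.submoduleOf, Submodule.comap_bot, Submodule.ker_subtype]
  let r : N.X (0 + 1) →ₗ[R] L := Submodule.inclusion hA1.le ∘ₗ
    (Submodule.quotEquivOfEqBot _ hK1).toLinearMap
  -- the inclusion of `L` as the cycles in degree `0`
  let j : L →ₗ[R] N.X 0 := ((A (0 + 2)).submoduleOf (A 0)).mkQ ∘ₗ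
    Submodule.inclusion (le_top : L ≤ A 0)
  have hj : Function.Injective j := by
    intro x y hxy
    exact Submodule.inclusion_injective _
      ((Submodule.quotEquivOfEqBot _ hK0).symm.injective hxy)
  have hr : ∀ z, j (r z) = (N.d (0 + 1) 0).hom z := by
    intro z
    obtain ⟨x, rfl⟩ := Submodule.Quotient.mk_surjective _ z
    exact (filtrationComplex_d A _ 0 x).symm
  have hrs : Function.Surjective r := by
    intro x
    exact ⟨Submodule.Quotient.mk ⟨x.1, hA1.ge x.2⟩, rfl⟩
  have hjd : ∀ x k, (N.d 0 k).hom (j x) = 0 := by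
    intro x k
    obtain ⟨z, rfl⟩ := hrs x
    rw [hr, d_d_apply]
  refine isFlat_of_lifts fun M instM instM' hMfp f => ?_
  have hM : N.X 0 ∈ subprojectivityDomain (ModuleCat.of R M) := by
    intro B g _ f'
    obtain ⟨k, hk⟩ := hN0.exists_lift (M := M) (p := g.hom)
      ((ModuleCat.epi_iff_surjective g).1 inferInstance) f'.hom
    exact ⟨ModuleCat.ofHom k, ModuleCat.hom_ext hk⟩
  have hepi : Epi (discCoverπ N) := epi_of_surjective _ (discCoverπ_surjective N)
  have hφ : ∀ k, ModuleCat.ofHom (j ∘ₗ f) ≫ N.d 0 k = 0 := fun k =>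
    ModuleCat.hom_ext (LinearMap.ext fun x => hjd (f x) k)
  let φ : shiftedSphere (ModuleCat.of R M) 0 ⟶ N :=
    HomologicalComplex.mkHomFromSingle (ModuleCat.ofHom (j ∘ₗ f)) fun k _ => hφ k
  obtain ⟨k, hk⟩ := h (ModuleCat.of R M) N hMfp hN 0 hM (discCoverπ N) φ
  let e := HomologicalComplex.singleObjXSelf (ComplexShape.down ℤ) 0 (ModuleCat.of R M)
  let κ : ModuleCat.of R M ⟶ (discCover N).X 0 := e.inv ≫ k.f 0
  have hκ : κ ≫ (discCoverπ N).f 0 = ModuleCat.ofHom (j ∘ₗ f) := by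
    have h1 : k.f 0 ≫ (discCoverπ N).f 0 = φ.f 0 := by
      rw [← hk, HomologicalComplex.comp_f]
    have h2 : φ.f 0 = e.hom ≫ ModuleCat.ofHom (j ∘ₗ f) :=
      HomologicalComplex.mkHomFromSingle_f _ _
    rw [Category.assoc, h1, h2, Iso.inv_hom_id_assoc]
  -- The sphere has zero differential, so the lift has values in cycles.
  have hκd : κ ≫ (discCover N).d 0 (-1) = 0 := by
    rw [Category.assoc, k.comm, HomologicalComplex.single_obj_d, Limits.zero_comp,
      Limits.comp_zero]
  let y : M →ₗ[R] (N.X (0 + 1) →₀ R) := discCoverSnd N 0 ∘ₗ κ.hom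
  have hy : ∀ x, f x = r (freeCover _ (y x)) := by
    intro x
    apply hj
    rw [hr]
    have h1 : ((discCoverπ N).f 0).hom (κ.hom x) = j (f x) :=
      LinearMap.congr_fun (congrArg ModuleCat.Hom.hom hκ) x
    have h2 : ((discCover N).d 0 (-1)).hom (κ.hom x) = 0 :=
      LinearMap.congr_fun (congrArg ModuleCat.Hom.hom hκd) x
    rw [← h1]
    exact discCoverπ_f_of_d_eq_zero N (by norm_num) _ h2
  -- `f` now factors through the free module on N_1, and a map from a free module to L lifts to the
  -- free cover of L.
  obtain ⟨l, hl⟩ := Module.projective_lifting_property (freeCover (R := R) L)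
    (r ∘ₗ freeCover (R := R) (N.X (0 + 1))) (freeCover_surjective L)
  refine ⟨l ∘ₗ y, LinearMap.ext fun x => ?_⟩
  rw [hy]
  exact LinearMap.congr_fun hl (y x)

end Filtration

/-! ### The tensor product complex: functoriality and zero differentials. -/

section TensorComplexLemmas

variable {R : Type u} [Ring R]
variable (E : ChainComplex (ModuleCat.{u} Rᵐᵒᵖ) ℤ) {F G H : ChainComplex (ModuleCat.{u} R) ℤ}

theorem tensorComplex_acyclic_iff (F : ChainComplex (ModuleCat.{u} R) ℤ) :
    (tensorComplex E F).Acyclic ↔ ∀ (l m n : ℤ) (h : m + 1 = l) (h' : n + 1 = m)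
      (x : tensorX E F m), tensorD E F m n h' x = 0 → ∃ y, tensorD E F l m h y = x := by
  have hd : ∀ (m n : ℤ) (h : n + 1 = m),
      (tensorComplex E F).d m n = AddCommGrpCat.ofHom (tensorD E F m n h) := fun m n h => dif_pos h
  constructor
  · intro hE l m n h h' x hx
    have := ((tensorComplex E F).exactAt_iff' l m n ((ComplexShape.down ℤ).prev_eq' h)
      ((ComplexShape.down ℤ).next_eq' h')).1 (hE m)
    obtain ⟨y, hy⟩ := (ShortComplex.ab_exact_iff _).1 this x (by
      change ((tensorComplex E F).d m n).hom x = 0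
      rw [hd m n h']; exact hx)
    refine ⟨y, ?_⟩
    change ((tensorComplex E F).d l m).hom y = x at hy
    rw [hd l m h] at hy
    exact hy
  · intro hE m
    have h' : m - 1 + 1 = m := sub_add_cancel m 1
    refine ((tensorComplex E F).exactAt_iff' (m + 1) m (m - 1) ((ComplexShape.down ℤ).prev_eq' rfl)
      ((ComplexShape.down ℤ).next_eq' h')).2 ((ShortComplex.ab_exact_iff _).2 fun x hx => ?_)
    change ((tensorComplex E F).d m (m - 1)).hom x = 0 at hx
    rw [hd m (m - 1) h'] at hx
    obtain ⟨y, hy⟩ := hE (m + 1) m (m - 1) rfl h' x hx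
    refine ⟨y, ?_⟩
    change ((tensorComplex E F).d (m + 1) m).hom y = x
    rw [hd (m + 1) m rfl]
    exact hy

theorem tensorX_hom_ext {A : Type*} [AddCommGroup A] {n : ℤ} {f g : tensorX E F n →+ A}
    (h : ∀ (i j : ℤ) (hij : i + j = n) (x : E.X i) (y : F.X j),
      f (tensorOf E F i j hij (rtmul R x y)) = g (tensorOf E F i j hij (rtmul R x y))) :
    f = g := by
  refine DirectSum.addHom_ext' ?_
  rintro ⟨⟨i, j⟩, hij⟩
  exact RTensor.addHom_ext R fun x y => h i j hij x y

/-- The map `E ⊗ φ` in degree `n`. -/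
noncomputable def tensorMap (φ : F ⟶ G) (n : ℤ) : tensorX E F n →+ tensorX E G n :=
  DirectSum.map fun p => RTensor.map R LinearMap.id (φ.f p.1.2).hom

theorem tensorMap_tensorOf (φ : F ⟶ G) {n : ℤ} (i j : ℤ) (h : i + j = n) (x : E.X i) (y : F.X j) :
    tensorMap E φ n (tensorOf E F i j h (rtmul R x y)) =
      tensorOf E G i j h (rtmul R x ((φ.f j).hom y)) :=
  DirectSum.map_of _ _ _

theorem tensorMap_apply (φ : F ⟶ G) {n : ℤ} (x : tensorX E F n)
    (p : {p : ℤ × ℤ // p.1 + p.2 = n}) :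
    tensorMap E φ n x p = RTensor.map R LinearMap.id (φ.f p.1.2).hom (x p) :=
  DirectSum.map_apply _ _ _

theorem tensorMap_tensorD (φ : F ⟶ G) (m n : ℤ) (h : n + 1 = m) (x : tensorX E F m) :
    tensorMap E φ n (tensorD E F m n h x) = tensorD E G m n h (tensorMap E φ m x) := by
  refine DFunLike.congr_fun (f := (tensorMap E φ n).comp (tensorD E F m n h))
    (g := (tensorD E G m n h).comp (tensorMap E φ m)) (tensorX_hom_ext E fun i j hij x y => ?_) x
  rw [AddMonoidHom.comp_apply, AddMonoidHom.comp_apply, tensorD_rtmul, map_add, map_zsmul,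
    tensorMap_tensorOf, tensorMap_tensorOf, tensorMap_tensorOf, tensorD_rtmul, f_d_apply φ]

theorem tensorMap_surjective (φ : F ⟶ G) (h : ∀ n, Function.Surjective (φ.f n)) (n : ℤ) :
    Function.Surjective (tensorMap E φ n) :=
  DirectSum.map_surjective _ |>.2 fun p =>
    RTensor.map_surjective R (f := (LinearMap.id : E.X p.1.1 →ₗ[Rᵐᵒᵖ] E.X p.1.1))
      Function.surjective_id (h p.1.2)

theorem tensorMap_injective (φ : F ⟶ G) (h : ∀ i j, Function.Injective
    (RTensor.map R (LinearMap.id : E.X i →ₗ[Rᵐᵒᵖ] E.X i) (φ.f j).hom)) (n : ℤ) :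
    Function.Injective (tensorMap E φ n) :=
  DirectSum.map_injective _ |>.2 fun p => h p.1.1 p.1.2

theorem tensorMap_exact (φ : F ⟶ G) (ψ : G ⟶ H)
    (h : ∀ n, Function.Exact (φ.f n).hom (ψ.f n).hom)
    (hψ : ∀ n, Function.Surjective (ψ.f n)) (n : ℤ) (x : tensorX E G n)
    (hx : tensorMap E ψ n x = 0) : ∃ y, tensorMap E φ n y = x := by
  classical
  have hx' : ∀ p, ∃ y, RTensor.map R LinearMap.id (φ.f p.1.2).hom y = x p := fun p => by
    refine (RTensor.exact_right R _ (h p.1.2) (hψ p.1.2) _).1 ?_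
    rw [← tensorMap_apply, hx]
    rfl
  choose y hy using hx'
  -- The chosen preimages need not vanish where x does, so they are cut off to the support of x.
  refine ⟨DirectSum.mk _ (DFinsupp.support x) fun p => y p, DFinsupp.ext fun p => ?_⟩
  have e := tensorMap_apply E φ (DirectSum.mk (fun p : {p : ℤ × ℤ // p.1 + p.2 = n} =>
    RTensor R (E.X p.1.1) (F.X p.1.2)) (DFinsupp.support x) fun p => y p) p
  refine e.trans ?_
  by_cases hp : p ∈ DFinsupp.support x
  · rw [DirectSum.mk_apply_of_mem hp, hy]
  · rw [DirectSum.mk_apply_of_notMem hp, map_zero]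
    exact (DFinsupp.notMem_support_iff.1 hp).symm

theorem tensorD_tensorOf_of_d_eq_zero (hF : ∀ i j, F.d i j = 0) (m n : ℤ) (h : n + 1 = m)
    (i i' j : ℤ) (hi : i - 1 = i') (hij : i + j = m) (h' : i' + j = n)
    (t : RTensor R (E.X i) (F.X j)) :
    tensorD E F m n h (tensorOf E F i j hij t) =
      tensorOf E F i' j h' (RTensor.map R (E.d i i').hom LinearMap.id t) := by
  refine DFunLike.congr_fun (f := (tensorD E F m n h).comp (tensorOf E F i j hij))
    (g := (tensorOf E F i' j h').comp (RTensor.map R (E.d i i').hom LinearMap.id))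
    (RTensor.addHom_ext R fun x y => ?_) t
  subst hi
  rw [AddMonoidHom.comp_apply, tensorD_rtmul, hF]
  change _ + _ • tensorOf E F i (j - 1) _ (rtmul R x 0) = _
  rw [rtmul_zero_right, map_zero, smul_zero, add_zero]
  rfl

/-- Only the (i, j) component contributes: E ⊗ F splits into shifted copies of the complexes E ⊗
F_j. -/
theorem tensorD_apply_of_d_eq_zero (hF : ∀ i j, F.d i j = 0) (m n : ℤ) (h : n + 1 = m)
    (x : tensorX E F m) (i i' j : ℤ) (hi : i - 1 = i') (hij : i + j = m) (h' : i' + j = n) :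
    tensorD E F m n h x ⟨(i', j), h'⟩ =
      RTensor.map R (E.d i i').hom LinearMap.id (x ⟨(i, j), hij⟩) := by
  classical
  induction x using DirectSum.induction_on with
  | zero => rw [map_zero]; exact (map_zero _).symm
  | add x y hx hy =>
    rw [map_add, DirectSum.add_apply, DirectSum.add_apply, hx, hy, map_add]
  | of p t =>
    obtain ⟨⟨k, l⟩, hkl⟩ := p
    change tensorD E F m n h (tensorOf E F k l hkl t) _ = _
    rw [tensorD_tensorOf_of_d_eq_zero E hF m n h k (k - 1) l rfl hkl (by omega)]
    by_cases hl : l = j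
    · obtain rfl := hl
      obtain rfl : k = i := by omega
      subst hi
      erw [DirectSum.of_eq_same, DirectSum.of_eq_same]
    · erw [DirectSum.of_eq_of_ne, DirectSum.of_eq_of_ne]
      · rw [map_zero]
      · exact fun e => hl (congrArg (fun p => p.1.2) e).symm
      · exact fun e => hl (congrArg (fun p => p.1.2) e).symm

/-- A complex of flat modules with zero differential is DG-flat. -/
theorem isDGFlat_of_d_eq_zero (hF : ∀ i j, F.d i j = 0) (hflat : ∀ n, IsFlat R (F.X n)) :
    IsDGFlat F := by
  classical
  refine ⟨hflat, fun E hE => ?_⟩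
  rw [acyclic_iff_exact] at hE
  rw [tensorComplex_acyclic_iff]
  rintro l m n h h' x hx
  have hx' : ∀ p : {p : ℤ × ℤ // p.1 + p.2 = m}, ∃ y,
      RTensor.map R (E.d (p.1.1 + 1) p.1.1).hom (LinearMap.id : F.X p.1.2 →ₗ[R] F.X p.1.2) y =
        x p := by
    rintro ⟨⟨i, j⟩, hij⟩
    refine ((hflat j).exact (hE (i + 1) i (i - 1) rfl (by omega)) _).1 ?_
    have := tensorD_apply_of_d_eq_zero E hF m n h' x i (i - 1) j rfl hij (by omega)
    rw [← this, hx]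
    rfl
  choose y hy using hx'
  refine ⟨∑ p ∈ DFinsupp.support x, tensorOf E F (p.1.1 + 1) p.1.2
    (by have := p.2; omega) (y p), ?_⟩
  rw [map_sum]
  conv_rhs => rw [← DirectSum.sum_support_of x]
  refine Finset.sum_congr rfl fun p _ => ?_
  rw [tensorD_tensorOf_of_d_eq_zero E hF l m h (p.1.1 + 1) p.1.1 p.1.2 (by omega) _ p.2, hy]
  rfl

end TensorComplexLemmas

/-! ### Cycles, boundaries and DG-flatness: assertions 1 and 4. -/

section Cycles

variable {R : Type u} [Ring R] (G : ChainComplex (ModuleCat.{u} R) ℤ)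

/-- The graded module of cycles, as a complex with zero differential. -/
noncomputable def cyclesComplex : ChainComplex (ModuleCat.{u} R) ℤ where
  X n := ModuleCat.of R (LinearMap.ker (G.d n (n - 1)).hom)
  d _ _ := 0

/-- The graded module of boundaries (shifted), as a complex with zero differential. -/
noncomputable def boundariesComplex : ChainComplex (ModuleCat.{u} R) ℤ where
  X n := ModuleCat.of R (LinearMap.range (G.d n (n - 1)).hom)
  d _ _ := 0

/-- The inclusion of the cycles. -/
noncomputable def cyclesι : cyclesComplex G ⟶ G where
  f n := ModuleCat.ofHom (LinearMap.ker (G.d n (n - 1)).hom).subtype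
  comm' i j hij := by
    obtain rfl : j = i - 1 := eq_sub_of_add_eq hij
    exact ModuleCat.hom_ext (LinearMap.ext fun x => x.2)

/-- The differential, as a chain map onto the boundaries. -/
noncomputable def boundariesπ : G ⟶ boundariesComplex G where
  f n := ModuleCat.ofHom (G.d n (n - 1)).hom.rangeRestrict
  comm' i j hij := by
    refine ModuleCat.hom_ext (LinearMap.ext fun x => Subtype.ext ?_)
    exact (d_d_apply G i j (j - 1) x).symm

theorem isDGFlat_of_submodulesOfFlatAreFlat (hS : SubmodulesOfFlatAreFlat R)
    (hG : ∀ n, IsFlat R (G.X n)) : IsDGFlat G := by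
  refine ⟨hG, fun E hE => ?_⟩
  have hZ : ∀ n, IsFlat R ((cyclesComplex G).X n) := fun n => hS _ (hG n) _
  have hB : ∀ n, IsFlat R ((boundariesComplex G).X n) := fun n => hS _ (hG (n - 1)) _
  have hEZ := (isDGFlat_of_d_eq_zero (F := cyclesComplex G) (fun _ _ => rfl) hZ).2 E hE
  have hEB := (isDGFlat_of_d_eq_zero (F := boundariesComplex G) (fun _ _ => rfl) hB).2 E hE
  rw [tensorComplex_acyclic_iff] at hEZ hEB ⊢
  have hex : ∀ n, Function.Exact ((cyclesι G).f n).hom ((boundariesπ G).f n).hom := fun n x =>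
    ⟨fun hx => ⟨⟨x, congrArg Subtype.val hx⟩, rfl⟩, by
      rintro ⟨z, rfl⟩
      exact Subtype.ext z.2⟩
  have hsurj : ∀ n, Function.Surjective ((boundariesπ G).f n).hom := fun n =>
    (G.d n (n - 1)).hom.surjective_rangeRestrict
  -- Flat boundaries make 0 → Z → G → B → 0 pure in each degree.
  have hinj : ∀ n, Function.Injective (tensorMap E (cyclesι G) n) :=
    tensorMap_injective E _ fun i j =>
      (hB j).pure (Subtype.val_injective) (hex j) (hsurj j) (E.X i)
  intro l m n h h' x hx
  -- The image of x in E ⊗ B bounds. Subtracting from x the boundary of a lift y leaves a cycle from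
  -- E ⊗ Z, which bounds too.
  obtain ⟨b, hb⟩ := hEB l m n h h' (tensorMap E (boundariesπ G) m x) (by
    rw [← tensorMap_tensorD, hx, map_zero])
  obtain ⟨y, rfl⟩ := tensorMap_surjective E (boundariesπ G) hsurj l b
  obtain ⟨z, hz⟩ := tensorMap_exact E (cyclesι G) (boundariesπ G) hex hsurj m
    (x - tensorD E G l m h y) (by rw [map_sub, tensorMap_tensorD, hb, sub_self])
  obtain ⟨w, rfl⟩ := hEZ l m n h h' z (by
    apply hinj
    rw [tensorMap_tensorD, hz, map_sub, hx, map_zero, zero_sub, neg_eq_zero]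
    exact DFunLike.congr_fun (tensorD_comp E G l m n h h') y)
  refine ⟨tensorMap E (cyclesι G) l w + y, ?_⟩
  rw [map_add, ← tensorMap_tensorD, hz, sub_add_cancel]

theorem isDGFlat_shiftedSphere (M : ModuleCat.{u} R) (n : ℤ) (hM : IsFlat R M) :
    IsDGFlat (shiftedSphere M n) := by
  refine isDGFlat_of_d_eq_zero (fun _ _ => rfl) fun m => ?_
  obtain rfl | hne := eq_or_ne m n
  · exact hM.of_equiv (HomologicalComplex.singleObjXSelf _ m M).toLinearEquiv
  · have := ModuleCat.subsingleton_of_isZero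
      (HomologicalComplex.isZero_single_obj_X (ComplexShape.down ℤ) n M m hne)
    exact isFlat_of_subsingleton

theorem submodulesOfFlatAreFlat_of_forall_isDGFlat
    (h : ∀ (F G : ChainComplex (ModuleCat.{u} R) ℤ) (i : G ⟶ F), Mono i →
      IsDGFlat F → IsDGFlat G) : SubmodulesOfFlatAreFlat R := by
  intro F _ _ hF L
  let i : ModuleCat.of R L ⟶ ModuleCat.of R F := ModuleCat.ofHom L.subtype
  have : Mono i := (ModuleCat.mono_iff_injective _).2 Subtype.val_injective
  have := (h _ _ ((HomologicalComplex.single (ModuleCat.{u} R) (ComplexShape.down ℤ) 0).map i)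
    inferInstance (isDGFlat_shiftedSphere (ModuleCat.of R F) 0 hF)).1 0
  exact this.of_equiv (HomologicalComplex.singleObjXSelf (ComplexShape.down ℤ) 0
    (ModuleCat.of R L)).symm.toLinearEquiv

end Cycles

end SubprojComplex

theorem proposition4p2 (R : Type u) [Ring R] :
    List.TFAE [
      -- the weak global dimension of `R` is at most `1`
      SubprojComplex.weakGlobalDimension R ≤ 1,
      ∀ M N : ChainComplex (ModuleCat.{u} R) ℤ,
        SubprojComplex.IsFinitelyPresentedComplex M → N.Acyclic →
        (∀ n : ℤ, N.X n ∈ SubprojComplex.subprojectivityDomain (M.X n)) →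
        N ∈ SubprojComplex.subprojectivityDomain M,
      ∀ (M : ModuleCat.{u} R) (N : ChainComplex (ModuleCat.{u} R) ℤ),
        Module.FinitePresentation R M → N.Acyclic →
        ∀ n : ℤ, N.X n ∈ SubprojComplex.subprojectivityDomain M →
          N ∈ SubprojComplex.subprojectivityDomain (SubprojComplex.shiftedSphere M n),
      -- subcomplexes are given by monomorphisms of complexes
      ∀ (F G : ChainComplex (ModuleCat.{u} R) ℤ) (i : G ⟶ F), Mono i →
        SubprojComplex.IsDGFlat F → SubprojComplex.IsDGFlat G] := by
  rw [SubprojComplex.weakGlobalDimension_le_one_iff]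
  tfae_have 1 → 2 := fun h _ _ hM hN hMN =>
    SubprojComplex.mem_subprojectivityDomain_of_submodulesOfFlatAreFlat h hM hN hMN
  tfae_have 2 → 3 := fun h M N _ hN n hMN =>
    h _ N (SubprojComplex.isFinitelyPresentedComplex_shiftedSphere M n) hN
      (SubprojComplex.mem_subprojectivityDomain_shiftedSphere_X hMN)
  tfae_have 3 → 1 := fun h _ _ _ hF L => SubprojComplex.isFlat_of_forall_shiftedSphere hF L h
  tfae_have 1 → 4 := fun h F G i _ hF =>
    SubprojComplex.isDGFlat_of_submodulesOfFlatAreFlat G h fun n => by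
      have : Mono (i.f n) := inferInstance
      let e := LinearEquiv.ofInjective (i.f n).hom ((ModuleCat.mono_iff_injective _).1 this)
      exact (h _ (hF.1 n) _).of_equiv e
  tfae_have 4 → 1 := SubprojComplex.submodulesOfFlatAreFlat_of_forall_isDGFlat
  tfae_finish
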